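/- A graph sharing game is played by Alice and Bob on a finite connected graph $G$ with nonnegative vertex weights, not all zero. The players alternately take one vertex per turn, Alice first. Consider the conditions: (T) the subgraph of $G$ induced by the taken vertices is connected during the whole game; (R) the subgraph of $G$ induced by the remaining vertices is connected (or empty) during the whole game. Game T, game R and game TR require (T), (R), and both (T) and (R), respectively; a game ends when no legal turn is left. Game TR is considered on $2$-connected graphs only. A graph is $k$-connected if it has more than $k$ vertices and the removal of any fewer than $k$ vertices leaves it connected. For $\varepsilon>0$, say that *Bob wins up to $\varepsilon$* if he has a strategy to obtain at least $(1-\varepsilon)$ of the total weight of the vertices of $G$. **Theorem.** For each of the games T, R and TR, every $\varepsilon>0$ and every integer $k\ge 1$ there is a $k$-connected vertex-weighted graph on which Bob wins up to $\varepsilon$. Moreover, there are both such graphs with an even number and such graphs with an odd number of vertices. More precisely, given $k\ge1$ and $\varepsilon>0$: 1. (Games T and TR, even.) For all sufficiently large $n$, take the cycle of length $2n$, replace each vertex by a clique with $2\lceil k/4\rceil$ vertices and each edge by a complete bipartite graph; give weight $1$ to one vertex in every other clique, and weight $0$ to all other vertices. This graph has an even number of vertices, is $k$-connected, and Bob wins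 up to $\varepsilon$ on it in game T and in game TR. 2. (Game R, odd.) For all sufficiently large $m$, let $Y$ be an $m$-element set, $Z$ the set of all $k$-element subsets of $Y$, and $X$ a set of $|Y|+|Z|+3$ elements; on the disjoint union of $X$, $Y$, $Z$ join all $x\in X$ to all $y\in Y$, and $y\in Y$ to $z\in Z$ whenever $y\in z$; give weight $1$ to the vertices in $Y$ and weight $0$ to all others. This graph is bipartite, has an odd number of vertices, is $k$-connected, and Bob wins up to $\varepsilon$ on it in game R. 3. (Games T and TR, odd.) Let $H_n$ be the graph with vertices $a_1,\dots,a_n$ of weight $1$, and $b_1,\dots,b_n$ and $c_S$ (for every non-empty $S\subseteq\{1,\dots,n\}$) of weight $0$, where $a_i$ is joined to $b_i$, and $c_S$ is joined to all $b_i$ with $i\in S$. Let $H_{n,k}$ be obtained by replacing each vertex of weight $0$ by a clique of $2k+1$ vertices of weight $0$, and each edge by a complete bipartite graph. For all sufficiently large $n$, $H_{n,k}$ has an odd number of vertices, is $(2k+1)$-connected, and Bob wins up to $\varepsilon$ on it in game T and in game TR. 4. (Game R, even.) Let $G'_{n,k}$ consist of a clique on vertices $a_1,\dots,a_n$ of weight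 $1$ and a vertex $b_S$ of weight $0$ for each $k$-element subset $S\subseteq\{1,\dots,n\}$, joined to all $a_i$ with $i\in S$. For all sufficiently large $m$ and $n=2^m$, $G'_{n,k}$ has an even number of vertices, is $k$-connected, and Bob wins up to $\varepsilon$ on it in game R. -/

import Mathlib

namespace GraphSharing

/-- The three games, named after the rules that they impose. -/
inductive Game where
  | T
  | R
  | TR

/-- The games in which the taken vertices have to induce a connected subgraph. -/
def Game.ruleT : Game → Prop
  | .T => True
  | .R => False
  | .TR => True

/-- The games in which the remaining vertices have to induce a connected subgraph. -/
def Game.ruleR : Game → Prop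
  | .T => False
  | .R => True
  | .TR => True

section Play

variable {V : Type}

/-- `v` can be taken when exactly the vertices of `taken` have been taken so far. Rule (R) is
stated with `Preconnected`, so that the very last vertex may be taken (the empty graph is
preconnected, but not connected, in Mathlib). -/
def Legal (g : Game) (G : SimpleGraph V) (taken : Set V) (v : V) : Prop :=
  v ∉ taken ∧
  (g.ruleT → (G.induce (insert v taken)).Connected) ∧
  (g.ruleR → (G.induce (insert v taken)ᶜ).Preconnected)

/-- The vertices taken in the course of a history. A history is the list of all turns made so
far, the most recent one first. -/
def takenSet (h : List V) : Set V := {v | v ∈ h}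

/-- The histories that can arise when Bob uses the strategy `σ` (which sees the whole history)
and Alice makes arbitrary legal turns. Alice has the first turn, so she is on turn after an even
number of turns and Bob is on turn after an odd number of turns. -/
inductive IsPlay (g : Game) (G : SimpleGraph V) (σ : List V → V) : List V → Prop
  | start : IsPlay g G σ []
  | alice (h : List V) (v : V) : IsPlay g G σ h → Even h.length →
      Legal g G (takenSet h) v → IsPlay g G σ (v :: h)
  | bob (h : List V) : IsPlay g G σ h → Odd h.length →
      Legal g G (takenSet h) (σ h) → IsPlay g G σ (σ h :: h)

open Classical in
/-- The total weight of the vertices that Bob took in a history. -/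
noncomputable def bobGain (w : V → ℝ) : List V → ℝ
  | [] => 0
  | v :: h => (if Odd h.length then w v else 0) + bobGain w h

/-- Bob has a strategy to obtain vertices of total weight at least `c`: the strategy gives a legal
turn whenever he is on turn and there is one, and whenever the game is over (no legal turn is
left), the vertices that he took have total weight at least `c`. -/
def BobCanSecure (g : Game) (G : SimpleGraph V) (w : V → ℝ) (c : ℝ) : Prop :=
  ∃ σ : List V → V, ∀ h : List V, IsPlay g G σ h →
    (Odd h.length → (∃ v, Legal g G (takenSet h) v) → Legal g G (takenSet h) (σ h)) ∧
    ((¬ ∃ v, Legal g G (takenSet h) v) → c ≤ bobGain w h)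

/-- A finite graph is `k`-connected if it has more than `k` vertices and stays connected after the
removal of any fewer than `k` vertices. -/
def IsKConnected [Fintype V] (G : SimpleGraph V) (k : ℕ) : Prop :=
  k < Fintype.card V ∧
  ∀ S : Finset V, S.card < k → (G.induce ((S : Set V)ᶜ)).Connected

/-- The weights are nonnegative and not all zero, and in game `g` on `G` Bob has a strategy to
obtain at least `1 - ε` of the total weight. -/
def BobGetsAlmostAll [Fintype V] (g : Game) (G : SimpleGraph V) (w : V → ℝ) (ε : ℝ) : Prop :=
  (∀ v, 0 ≤ w v) ∧ 0 < ∑ v, w v ∧ BobCanSecure g G w ((1 - ε) * ∑ v, w v)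

/-- The graph obtained from `G` by replacing each vertex `v` by a clique with `s v` vertices and
each edge by a complete bipartite graph. -/
def blowUp (G : SimpleGraph V) (s : V → ℕ) : SimpleGraph (Σ v : V, Fin (s v)) where
  Adj p q := p ≠ q ∧ (p.1 = q.1 ∨ G.Adj p.1 q.1)
  symm := ⟨fun _ _ h => ⟨h.1.symm, h.2.imp Eq.symm fun e => e.symm⟩⟩
  loopless := ⟨fun _ h => h.1 rfl⟩

end Play

/-- The vertices of the blow-up of the cycle of length `2 * n` in which each vertex is replaced by
a clique with `2 * ⌈k / 4⌉` vertices. -/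
abbrev CycleVertex (n k : ℕ) : Type := Σ _ : Fin (2 * n), Fin (2 * (k ⌈/⌉ 4))

/-- The blown-up even cycle. -/
def cycleBlowUp (n k : ℕ) : SimpleGraph (CycleVertex n k) :=
  blowUp (SimpleGraph.cycleGraph (2 * n)) fun _ => 2 * (k ⌈/⌉ 4)

/-- Weight `1` at one vertex in every other clique, weight `0` elsewhere. -/
def cycleWeight (n k : ℕ) (p : CycleVertex n k) : ℝ :=
  if Even p.1.val ∧ p.2.val = 0 then 1 else 0

/-- The vertices of the incidence graph: the sets `X`, `Y` and `Z`, in this order. `Y` has `m`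
elements, `Z` consists of the `k`-element subsets of `Y`, and `X` has `|Y| + |Z| + 3` elements. -/
abbrev XYZVertex (m k : ℕ) : Type :=
  Fin (m + m.choose k + 3) ⊕ (Fin m ⊕ {S : Finset (Fin m) // S.card = k})

/-- All edges between `X` and `Y`, and an edge between `y ∈ Y` and `z ∈ Z` if `y ∈ z`
(`fromRel` makes the relation symmetric). -/
def xyzGraph (m k : ℕ) : SimpleGraph (XYZVertex m k) :=
  SimpleGraph.fromRel fun p q => match p, q with
    | .inl _, .inr (.inl _) => True
    | .inr (.inl y), .inr (.inr z) => y ∈ z.1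
    | _, _ => False

/-- Weight `1` on `Y`, weight `0` elsewhere. -/
def xyzWeight (m k : ℕ) : XYZVertex m k → ℝ
  | .inr (.inl _) => 1
  | _ => 0

/-- The vertices `a i`, `b i` and `c S`, in this order, of the Micek–Walczak graph. -/
abbrev MWVertex (n : ℕ) : Type :=
  Fin n ⊕ (Fin n ⊕ {S : Finset (Fin n) // S.Nonempty})

/-- The Micek–Walczak graph: `a i` is joined to `b i`, and `c S` to all `b i` with `i ∈ S`. -/
def mwGraph (n : ℕ) : SimpleGraph (MWVertex n) :=
  SimpleGraph.fromRel fun p q => match p, q with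
    | .inl i, .inr (.inl j) => i = j
    | .inr (.inl i), .inr (.inr S) => i ∈ S.1
    | _, _ => False

/-- The sizes of the cliques in the blow-up: `1` for the vertices `a i`, and `2 * k + 1` for all
the other vertices. -/
def mwSize (n k : ℕ) : MWVertex n → ℕ
  | .inl _ => 1
  | .inr _ => 2 * k + 1

/-- The blow-up of the Micek–Walczak graph. -/
def mwBlowUp (n k : ℕ) : SimpleGraph (Σ v : MWVertex n, Fin (mwSize n k v)) :=
  blowUp (mwGraph n) (mwSize n k)

/-- Weight `1` on the vertices `a i`, weight `0` elsewhere. -/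
def mwWeight (n k : ℕ) (p : Σ v : MWVertex n, Fin (mwSize n k v)) : ℝ :=
  match p.1 with
  | .inl _ => 1
  | .inr _ => 0

/-- The vertices `a i` and `b S`, in this order. -/
abbrev CliqueVertex (n k : ℕ) : Type :=
  Fin n ⊕ {S : Finset (Fin n) // S.card = k}

/-- The vertices `a i` form a clique, and `b S` is joined to all `a i` with `i ∈ S`. -/
def cliqueGraph (n k : ℕ) : SimpleGraph (CliqueVertex n k) :=
  SimpleGraph.fromRel fun p q => match p, q with
    | .inl _, .inl _ => True
    | .inl i, .inr S => i ∈ S.1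
    | _, _ => False

/-- Weight `1` on the vertices `a i`, weight `0` elsewhere. -/
def cliqueWeight (n k : ℕ) : CliqueVertex n k → ℝ
  | .inl _ => 1
  | .inr _ => 0

end GraphSharing

open GraphSharing

/-! In every game Bob answers each turn of Alice so that an invariant about the taken set `T` and
his own set `B` is restored, until his share is large enough; `bobCanSecure_of_invariant` turns such
an invariant into a strategy. The common mechanism is that making a vertex of weight `1` available
hands it to the opponent, while parity gives Bob a harmless waiting turn whenever he needs one.

Games T and TR. On the blown-up cycle, connectedness lets Alice enter a clique with weight only
after a neighbouring clique has been touched. When she opens a weightless clique next to an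
untouched clique with weight, Bob takes the vertex of weight `1` there. Otherwise he plays inside
the touched cliques: together they have an even number of vertices, and an odd number of vertices is
taken after Alice's turn, so one is left. Only one clique with weight, fixed near the start, can
escape him (`bobCanSecure_blowUp_of_bipartite`). On the blown-up Micek–Walczak graph the only access
to `a i` is through the clique of `b i`. When Alice opens it, Bob takes `a i`; otherwise he waits in
the region of the opened indices, which is even as long as some index is unopened
(`even_card_inRegion`, `bobCanSecure_mwBlowUp`). Rule (R) does not interfere: a vertex of a clique
with a remaining twin is never a cut vertex, and since the part of the graph outside the region
stays connected, `exists_preconnected_compl_insert` finds a waiting turn that does not disconnect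
the rest.

Game R. Here `y i` has weight `1` and `z S` is attached to the `k` vertices `y i` with `i ∈ S`, so
`y i` is blocked while it is the last remaining neighbour of a remaining `z S`. Bob takes an
unblocked (`Free`) `y i` if there is one. If there is none, he takes a vertex that unblocks nothing.
Should no `z S` qualify, the remaining `y i` and `z S` are perfectly matched
(`exists_matching_of_not_free`), and parity either excludes this (clique graph) or provides a spare
vertex of `X`. Alice can then unblock at most one `y i` per turn, which Bob takes. The number of
vertices lost to Alice plus the number of free ones therefore stays bounded in terms of `k` after a
short opening phase in which all remaining `y i` are free (`IncidenceGame.bobCanSecure`). -/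

namespace GraphSharing

open Finset

/-! ### Connectivity of induced subgraphs and of blow-ups. -/

section Connectivity

variable {V : Type} {G : SimpleGraph V}

/-- A preconnected set that meets both a set and its complement contains an edge between them. -/
theorem exists_adj_of_preconnected {A : Set V} (hA : (G.induce A).Preconnected) (W : Set V)
    {a b : V} (ha : a ∈ A) (hb : b ∈ A) (haW : a ∈ W) (hbW : b ∉ W) :
    ∃ x y, x ∈ A ∧ y ∈ A ∧ x ∈ W ∧ y ∉ W ∧ G.Adj x y := by
  obtain ⟨p⟩ := hA ⟨a, ha⟩ ⟨b, hb⟩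
  obtain ⟨d, -, h1, h2⟩ := p.exists_boundary_dart {x | x.1 ∈ W} haW hbW
  exact ⟨d.fst, d.snd, d.fst.2, d.snd.2, h1, h2, d.adj⟩

theorem preconnected_of_forall_reachable {W : Type} {H : SimpleGraph W} (r : W)
    (h : ∀ x, H.Reachable x r) : H.Preconnected :=
  fun x y => (h x).trans (h y).symm

/-- Walks are transported edge by edge. Asking only for reachability of the images allows edges to
collapse, as they do under retractions. -/
theorem preconnected_of_surjective {W W' : Type} {H : SimpleGraph W} {H' : SimpleGraph W'}
    (hH : H.Preconnected) (f : W → W') (hf : Function.Surjective f)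
    (h : ∀ x y, H.Adj x y → H'.Reachable (f x) (f y)) : H'.Preconnected := by
  intro a b
  obtain ⟨x, rfl⟩ := hf a
  obtain ⟨y, rfl⟩ := hf b
  obtain ⟨p⟩ := hH x y
  induction p with
  | nil => exact .refl _
  | cons hadj _ ih => exact (h _ _ hadj).trans ih

/-- Removing a vertex whose remaining neighbours are all dominated by another remaining vertex
does not disconnect the graph. -/
theorem preconnected_compl_insert_of_dominated {T : Set V} (hT : (G.induce Tᶜ).Preconnected)
    {v v' : V} (hv' : v' ∉ T) (hne : v' ≠ v)
    (hdom : ∀ z, z ∉ T → G.Adj v z → z = v' ∨ G.Adj v' z) :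
    (G.induce (insert v T)ᶜ).Preconnected := by
  classical
  have hmem : ∀ x : (Tᶜ : Set V), x.1 ≠ v → x.1 ∈ (insert v T)ᶜ := fun x hx => by
    simpa [not_or] using ⟨hx, x.2⟩
  have hv'' : v' ∈ (insert v T)ᶜ := by simpa [not_or] using ⟨hne, hv'⟩
  -- Retract `v` onto `v'`: by domination, every edge at `v` becomes an edge at `v'` or collapses.
  refine preconnected_of_surjective hT
    (fun x => if hx : x.1 = v then ⟨v', hv''⟩ else ⟨x.1, hmem x hx⟩) ?_ ?_
  · rintro ⟨x, hx⟩
    have hx' : x ≠ v ∧ x ∉ T := by simpa [not_or] using hx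
    exact ⟨⟨x, hx'.2⟩, by simp [hx'.1]⟩
  · rintro ⟨x, hx⟩ ⟨y, hy⟩ hadj
    have hadj' : G.Adj x y := hadj
    by_cases hxv : x = v
    · by_cases hyv : y = v
      · exact absurd (hxv.trans hyv.symm) hadj'.ne
      · simp only [hxv, hyv, dif_pos, dif_neg, not_false_eq_true]
        rcases hdom y hy (hxv ▸ hadj') with h | h
        · subst h; exact .refl _
        · exact SimpleGraph.Adj.reachable (by exact h)
    · by_cases hyv : y = v
      · simp only [hxv, hyv, dif_pos, dif_neg, not_false_eq_true]
        rcases hdom x hx (hyv ▸ hadj'.symm) with h | h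
        · subst h; exact .refl _
        · exact SimpleGraph.Adj.reachable (by exact h.symm)
      · simp only [hxv, hyv, dif_neg, not_false_eq_true]
        exact SimpleGraph.Adj.reachable (by exact hadj')

theorem preconnected_insert {A : Set V} (hA : (G.induce A).Preconnected) {v a : V} (ha : a ∈ A)
    (hva : G.Adj v a) : (G.induce (insert v A)).Preconnected := by
  have key : ∀ x (hx : x ∈ A),
      (G.induce (insert v A)).Reachable ⟨x, Or.inr hx⟩ ⟨a, Or.inr ha⟩ := fun x hx =>
    (hA ⟨x, hx⟩ ⟨a, ha⟩).map
      (⟨fun x => ⟨x.1, Or.inr x.2⟩, fun h => h⟩ : G.induce A →g G.induce (insert v A))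
  refine preconnected_of_forall_reachable ⟨a, Or.inr ha⟩ ?_
  rintro ⟨x, hx | hx⟩
  · subst hx
    exact SimpleGraph.Adj.reachable (by exact hva)
  · exact key x hx

theorem preconnected_singleton (v : V) : (G.induce {v}).Preconnected := by
  rintro ⟨x, hx⟩ ⟨y, hy⟩
  have hx' : x = v := hx
  have hy' : y = v := hy
  subst hx' hy'
  exact .refl _

theorem connected_iff_preconnected {A : Set V} :
    (G.induce A).Connected ↔ (G.induce A).Preconnected ∧ A.Nonempty := by
  rw [SimpleGraph.connected_iff, Set.nonempty_coe_sort]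

theorem connected_insert {A : Set V} (hA : (G.induce A).Connected) {v a : V} (ha : a ∈ A)
    (hva : G.Adj v a) : (G.induce (insert v A)).Connected :=
  connected_iff_preconnected.2 ⟨preconnected_insert hA.preconnected ha hva, v, Or.inl rfl⟩

/-- A connected graph has a vertex outside any given connected part whose removal leaves it
connected. -/
theorem exists_preconnected_compl_insert [Finite V] {T : Set V}
    (hT : (G.induce Tᶜ).Preconnected) {U : Set V} (hU : (G.induce U).Preconnected)
    (hUT : U ⊆ Tᶜ) (hne : ∃ v, v ∉ T ∧ v ∉ U) :
    ∃ v, v ∉ T ∧ v ∉ U ∧ (G.induce (insert v T)ᶜ).Preconnected := by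
  -- A maximal connected proper subset containing `U` misses exactly one vertex: otherwise it could
  -- be enlarged by a neighbour and stay proper. The missed vertex is the one to remove.
  obtain ⟨W, hUW, hW⟩ := (Set.toFinite {W : Set V | (G.induce W).Preconnected ∧ W ⊂ Tᶜ}
    ).exists_le_maximal (a := U) ⟨hU, by
      obtain ⟨v, h1, h2⟩ := hne
      exact ⟨hUT, fun h => h2 (h h1)⟩⟩
  obtain ⟨⟨hWp, hWT⟩, hmax⟩ := hW
  obtain ⟨v, hvT, hvW, hpre⟩ : ∃ v, v ∉ T ∧ v ∉ W ∧ (G.induce (insert v W)).Preconnected := by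
    obtain ⟨v, hvT, hvW⟩ := Set.exists_of_ssubset hWT
    rcases W.eq_empty_or_nonempty with rfl | ⟨w, hw⟩
    · exact ⟨v, hvT, hvW, by rw [insert_empty_eq]; exact preconnected_singleton v⟩
    · obtain ⟨x, y, -, hy, hxW, hyW, hadj⟩ :=
        exists_adj_of_preconnected hT W (hWT.1 hw) hvT hw hvW
      exact ⟨y, hy, hyW, preconnected_insert hWp hxW hadj.symm⟩
  refine ⟨v, hvT, fun h => hvW (hUW h), ?_⟩
  have hsub : insert v W ⊆ Tᶜ := Set.insert_subset hvT hWT.1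
  have heq : insert v W = Tᶜ := by
    by_contra h
    exact hvW (hmax ⟨hpre, hsub, fun h' => h (hsub.antisymm h')⟩ (Set.subset_insert v W)
      (Set.mem_insert v W))
  have : (insert v T)ᶜ = W := by
    ext x
    have := Set.ext_iff.1 heq x
    simp only [Set.mem_insert_iff, Set.mem_compl_iff] at this ⊢
    constructor
    · rintro h
      exact (this.2 fun h' => h (Or.inr h')).resolve_left fun h' => h (Or.inl h')
    · rintro h (rfl | h')
      · exact hvW h
      · exact this.1 (Or.inr h) h'
  rwa [this]

/-- A vertex set of a blow-up is preconnected if its projection to the base graph is. -/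
theorem preconnected_blowUp {s : V → ℕ} {A : Set (Σ v : V, Fin (s v))}
    (hA : (G.induce (Sigma.fst '' A)).Preconnected) : ((blowUp G s).induce A).Preconnected := by
  have key : ∀ i j : (Sigma.fst '' A : Set V), (G.induce (Sigma.fst '' A)).Walk i j →
      ∀ p q : A, p.1.1 = i.1 → q.1.1 = j.1 → ((blowUp G s).induce A).Reachable p q := by
    intro i j w
    induction w with
    | nil =>
      intro p q hp hq
      by_cases hpq : p = q
      · rw [hpq]
      · exact SimpleGraph.Adj.reachable
          ⟨fun h => hpq (Subtype.ext h), Or.inl (hp.trans hq.symm)⟩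
    | @cons u v w hadj _ ih =>
      intro p q hp hq
      obtain ⟨r, hr, hrv⟩ := v.2
      have hadj' : G.Adj u.1 v.1 := hadj
      refine .trans (SimpleGraph.Adj.reachable ?_) (ih ⟨r, hr⟩ q hrv hq)
      refine ⟨fun h => hadj'.ne ?_, Or.inr (show G.Adj p.1.1 r.1 by rw [hp, hrv]; exact hadj')⟩
      rw [← hp, ← hrv]
      exact congrArg Sigma.fst h
  intro p q
  obtain ⟨w⟩ := hA ⟨p.1.1, p.1, p.2, rfl⟩ ⟨q.1.1, q.1, q.2, rfl⟩
  exact key _ _ w p q rfl rfl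

theorem preconnected_blowUp_fst {s : V → ℕ} (hs : ∀ v, 0 < s v) {I : Set V}
    (hI : (G.induce I).Preconnected) :
    ((blowUp G s).induce {p | p.1 ∈ I}).Preconnected := by
  refine preconnected_blowUp ?_
  have : Sigma.fst '' {p : Σ v : V, Fin (s v) | p.1 ∈ I} = I := by
    ext v
    exact ⟨fun ⟨p, hp, h⟩ => h ▸ hp, fun hv => ⟨⟨v, ⟨0, hs v⟩⟩, hv, rfl⟩⟩
  rwa [this]

/-- Vertices in the same clique of a blow-up have the same closed neighbourhoods. -/
theorem blowUp_adj_of_fst_eq {s : V → ℕ} {p p' z : Σ v : V, Fin (s v)} (h : p.1 = p'.1)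
    (hz : (blowUp G s).Adj p z) : z = p' ∨ (blowUp G s).Adj p' z := by
  by_cases hzp : z = p'
  · exact Or.inl hzp
  · exact Or.inr ⟨fun e => hzp e.symm, by rw [← h]; exact hz.2⟩

theorem IsKConnected.mono [Fintype V] {k l : ℕ} (hkl : k ≤ l) (h : IsKConnected G l) :
    IsKConnected G k :=
  ⟨hkl.trans_lt h.1, fun S hS => h.2 S (hS.trans_le hkl)⟩

end Connectivity

/-! ### Legal turns and strategies obtained from invariants. -/

section Strategy

variable {V : Type} {g : Game} {G : SimpleGraph V}

theorem Legal.exists_adj {T : Set V} {v : V} (hg : g.ruleT) (hv : Legal g G T v)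
    (hT : T.Nonempty) : ∃ t ∈ T, G.Adj v t := by
  obtain ⟨a, ha⟩ := hT
  obtain ⟨x, y, -, hy, hx, hyv, hadj⟩ := exists_adj_of_preconnected (hv.2.1 hg).preconnected {v}
    (Set.mem_insert v T) (Set.mem_insert_of_mem v ha) rfl (fun h => hv.1 (h ▸ ha))
  rw [Set.mem_singleton_iff] at hx
  subst hx
  exact ⟨y, hy.resolve_left hyv, hadj⟩

theorem legal_of_adj {T : Set V} {v t : V} (hT : g.ruleT → (G.induce T).Connected) (hv : v ∉ T)
    (ht : t ∈ T) (hvt : G.Adj v t)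
    (hR : g.ruleR → (G.induce (insert v T)ᶜ).Preconnected) : Legal g G T v :=
  ⟨hv, fun h => connected_insert (hT h) ht hvt, hR⟩

/-- The taken vertices and, if rule (R) is in force, the remaining vertices are connected. -/
structure IsPosition (g : Game) (G : SimpleGraph V) (T : Finset V) : Prop where
  taken : T.Nonempty → (G.induce (T : Set V)).Connected
  remaining : g.ruleR → (G.induce (T : Set V)ᶜ).Preconnected

theorem isPosition_empty (hG : G.Preconnected) : IsPosition g G ∅ where
  taken h := absurd h not_nonempty_empty
  remaining _ := by
    rw [coe_empty, Set.compl_empty]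
    exact (SimpleGraph.induceUnivIso G).preconnected_iff.2 hG

theorem IsPosition.insert [DecidableEq V] {T : Finset V} {v : V} (hg : g.ruleT)
    (hv : Legal g G (T : Set V) v) : IsPosition g G (insert v T) where
  taken _ := by rw [coe_insert]; exact hv.2.1 hg
  remaining hR := by rw [coe_insert]; exact hv.2.2 hR

/-- A vertex that is dominated by another remaining vertex can be taken. -/
theorem IsPosition.legal_of_dominated {T : Finset V} (hT : IsPosition g G T) {v v' : V}
    (hv : v ∉ T) (hv' : v' ∉ T) (hne : v' ≠ v)
    (hdom : ∀ z, z ∉ T → G.Adj v z → z = v' ∨ G.Adj v' z)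
    (hadj : T = ∅ ∨ ∃ t ∈ T, G.Adj v t) : Legal g G (T : Set V) v := by
  have hR : g.ruleR → (G.induce (Insert.insert v (T : Set V))ᶜ).Preconnected := fun hR =>
    preconnected_compl_insert_of_dominated (hT.remaining hR) hv' hne hdom
  rcases hadj with rfl | ⟨t, ht, hvt⟩
  · refine ⟨hv, fun _ => ?_, hR⟩
    rw [coe_empty, insert_empty_eq]
    exact connected_iff_preconnected.2 ⟨preconnected_singleton v, v, rfl⟩
  · exact legal_of_adj (fun _ => hT.taken ⟨t, ht⟩) hv ht hvt hR

/-- A vertex of a blow-up can be taken if another vertex of its clique remains. -/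
theorem IsPosition.legal_of_twin {s : V → ℕ} {T : Finset (Σ v : V, Fin (s v))}
    (hT : IsPosition g (blowUp G s) T) {p p' : Σ v : V, Fin (s v)} (hp : p ∉ T) (hp' : p' ∉ T)
    (hne : p' ≠ p) (h : p.1 = p'.1) (hadj : T = ∅ ∨ ∃ t ∈ T, (blowUp G s).Adj p t) :
    Legal g (blowUp G s) (T : Set (Σ v : V, Fin (s v))) p :=
  hT.legal_of_dominated hp hp' hne (fun _ _ hz => blowUp_adj_of_fst_eq h hz) hadj

/-- A move inside a region all of whose vertices are adjacent to taken ones, where the rest of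
the graph is connected. -/
theorem IsPosition.exists_legal [Finite V] {T : Finset V} (hT : IsPosition g G T) {U : Set V}
    (hU : (G.induce U).Preconnected) (hUT : ∀ v ∈ U, v ∉ T)
    (hadj : ∀ v, v ∉ T → v ∉ U → ∃ t ∈ T, G.Adj v t)
    (hne : ∃ v, v ∉ T ∧ v ∉ U) : ∃ v, v ∉ U ∧ Legal g G (T : Set V) v := by
  obtain ⟨v, hvT, hvU, hR⟩ : ∃ v, v ∉ T ∧ v ∉ U ∧
      (g.ruleR → (G.induce (Insert.insert v (T : Set V))ᶜ).Preconnected) := by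
    by_cases hg : g.ruleR
    · obtain ⟨v, h1, h2, h3⟩ :=
        exists_preconnected_compl_insert (hT.remaining hg) hU hUT hne
      exact ⟨v, h1, h2, fun _ => h3⟩
    · obtain ⟨v, h1, h2⟩ := hne
      exact ⟨v, h1, h2, fun h => absurd h hg⟩
  obtain ⟨t, ht, hvt⟩ := hadj v hvT hvU
  exact ⟨v, hvU, legal_of_adj (fun _ => hT.taken ⟨t, ht⟩) hvT ht hvt hR⟩

theorem BobCanSecure.mono {w : V → ℝ} {c c' : ℝ} (h : BobCanSecure g G w c) (hc : c' ≤ c) :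
    BobCanSecure g G w c' := by
  obtain ⟨σ, hσ⟩ := h
  exact ⟨σ, fun h hh => ⟨(hσ h hh).1, fun he => hc.trans ((hσ h hh).2 he)⟩⟩

/-- The vertices that Bob took in a history. -/
def bobFinset [DecidableEq V] : List V → Finset V
  | [] => ∅
  | v :: h => if Odd h.length then insert v (bobFinset h) else bobFinset h

theorem sum_bobFinset_le [DecidableEq V] {w : V → ℝ} (hw : ∀ v, 0 ≤ w v) (h : List V) :
    ∑ v ∈ bobFinset h, w v ≤ bobGain w h := by
  induction h with
  | nil => simp [bobFinset, bobGain]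
  | cons v h ih =>
    simp only [bobFinset, bobGain]
    split_ifs
    · by_cases hv : v ∈ bobFinset h
      · rw [insert_eq_of_mem hv]
        exact le_add_of_nonneg_of_le (hw v) ih
      · rw [sum_insert hv]
        linarith
    · simpa using ih

theorem bobGain_le_cons {w : V → ℝ} (hw : ∀ v, 0 ≤ w v) (v : V) (h : List V) :
    bobGain w h ≤ bobGain w (v :: h) := by
  simp only [bobGain]
  split_ifs
  · linarith [hw v]
  · simp

/-- Bob secures `c` if he can maintain an invariant, about the set `T` of the taken vertices and
the set `B` of those taken by him, until he has vertices of total weight at least `c`. -/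
theorem bobCanSecure_of_invariant [Nonempty V] [DecidableEq V] {w : V → ℝ} (hw : ∀ v, 0 ≤ w v) {c : ℝ}
    (P : Finset V → Finset V → Prop) (start : P ∅ ∅)
    (alive : ∀ T B, P T B → c ≤ ∑ v ∈ B, w v ∨ ∃ v, Legal g G (T : Set V) v)
    (reply : ∀ T B, P T B → ∀ v, Legal g G (T : Set V) v → c ≤ ∑ v ∈ B, w v ∨
      ∃ u, Legal g G ((insert v T : Finset V) : Set V) u ∧ P (insert u (insert v T)) (insert u B)) :
    BobCanSecure g G w c := by
  classical
  have htaken : ∀ h : List V, takenSet h = (h.toFinset : Set V) := fun h => by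
    ext v; simp [takenSet]
  let good : List V → V → Prop := fun h u => Legal g G (takenSet h) u ∧
    P (insert u h.toFinset) (insert u (bobFinset h))
  -- Off the invariant any legal turn will do; the arbitrary vertex is used only when no legal turn
  -- exists.
  let σ : List V → V := fun h =>
    if H : ∃ u, good h u then H.choose
    else if H' : ∃ u, Legal g G (takenSet h) u then H'.choose else Classical.arbitrary V
  have hσ1 : ∀ h, (∃ u, good h u) → good h (σ h) := fun h H => by
    simp only [σ, dif_pos H]
    exact H.choose_spec
  have hσ2 : ∀ h, (∃ u, Legal g G (takenSet h) u) → Legal g G (takenSet h) (σ h) := fun h H => by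
    by_cases H1 : ∃ u, good h u
    · exact (hσ1 h H1).1
    · simp only [σ, dif_neg H1, dif_pos H]
      exact H.choose_spec
  -- The first alternative persists because weights are nonnegative, so the invariant may be
  -- abandoned once the target is reached.
  have inv : ∀ h, IsPlay g G σ h → c ≤ bobGain w h ∨
      (Even h.length → P h.toFinset (bobFinset h)) ∧ (Odd h.length → ∃ u, good h u) := by
    intro h hh
    induction hh with
    | start => exact Or.inr ⟨fun _ => by simpa [bobFinset] using start, by simp⟩
    | alice h v _ hlen hv ih =>
      rcases ih with ih | ih
      · exact Or.inl (ih.trans (bobGain_le_cons hw _ _))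
      · rw [htaken] at hv
        rcases reply _ _ (ih.1 hlen) v hv with h1 | ⟨u, hu, hP⟩
        · exact Or.inl ((h1.trans (sum_bobFinset_le hw h)).trans (bobGain_le_cons hw _ _))
        · refine Or.inr ⟨fun he => ?_, fun _ => ⟨u, ?_, ?_⟩⟩
          · rw [List.length_cons] at he
            exact absurd hlen (Nat.even_add_one.1 he)
          · rw [htaken]; simpa using hu
          · have : ¬ Odd h.length := Nat.not_odd_iff_even.2 hlen
            simpa [bobFinset, this] using hP
    | bob h _ hlen hv ih =>
      rcases ih with ih | ih
      · exact Or.inl (ih.trans (bobGain_le_cons hw _ _))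
      · refine Or.inr ⟨fun _ => ?_, fun ho => ?_⟩
        · have := (hσ1 h (ih.2 hlen)).2
          simpa [bobFinset, hlen] using this
        · rw [List.length_cons] at ho
          exact absurd hlen (Nat.not_odd_iff_even.2 (Nat.odd_add_one.1 ho |> Nat.not_odd_iff_even.1))
  refine ⟨σ, fun h hh => ⟨fun _ H => hσ2 h H, fun hend => ?_⟩⟩
  rcases inv h hh with h1 | h1
  · exact h1
  · rcases Nat.even_or_odd h.length with he | ho
    · rcases alive _ _ (h1.1 he) with h2 | h2
      · exact h2.trans (sum_bobFinset_le hw h)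
      · rw [← htaken] at h2
        exact absurd h2 hend
    · obtain ⟨u, hu⟩ := h1.2 ho
      exact absurd ⟨u, hu.1⟩ hend

/-- Distinct vertices of weight `1` that Bob took contribute to his total. -/
theorem card_le_sum_of_mem {ι : Type} {w : V → ℝ} (hw : ∀ v, 0 ≤ w v) {f : ι → V}
    (hf : Function.Injective f) (hwf : ∀ i, w (f i) = 1 ) (s : Finset ι) {B : Finset V}
    (h : ∀ i ∈ s, f i ∈ B) : (s.card : ℝ) ≤ ∑ v ∈ B, w v := by
  classical
  calc (s.card : ℝ) = ∑ v ∈ s.image f, w v := by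
        rw [sum_image hf.injOn]; simp [hwf]
    _ ≤ _ := sum_le_sum_of_subset_of_nonneg (by
        intro v hv
        obtain ⟨i, hi, rfl⟩ := mem_image.1 hv
        exact h i hi) fun v _ _ => hw v

end Strategy

/-! ### Games T and TR on blow-ups of bipartite graphs with maximum degree two. -/

section Cycle

variable {ι : Type} {C : SimpleGraph ι} {q : ℕ}

/-- No vertex of the clique that replaces `i` is in `T`. -/
def Untouched (T : Finset (Σ _ : ι, Fin q)) (i : ι) : Prop := ∀ p ∈ T, p.1 ≠ i

theorem untouched_insert [DecidableEq ι] {T : Finset (Σ _ : ι, Fin q)} {v : Σ _ : ι, Fin q} {i : ι} :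
    Untouched (insert v T) i ↔ v.1 ≠ i ∧ Untouched T i := by
  simp [Untouched]

theorem not_untouched {T : Finset (Σ _ : ι, Fin q)} {i : ι} :
    ¬ Untouched T i ↔ ∃ p ∈ T, p.1 = i := by
  simp [Untouched]

/-- The untouched part of a graph with maximum degree two stays connected when the touched part
grows. -/
theorem preconnected_untouched_insert [DecidableEq ι]
    (hdeg : ∀ i x y z, C.Adj i x → C.Adj i y → C.Adj i z → x = y ∨ x = z ∨ y = z)
    (hdel : ∀ i, (C.induce {i}ᶜ).Preconnected) {T : Finset (Σ _ : ι, Fin q)}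
    (hU : (C.induce {i | Untouched T i}).Preconnected) {v : Σ _ : ι, Fin q}
    (hv : T = ∅ ∨ ∃ t ∈ T, t.1 = v.1 ∨ C.Adj v.1 t.1) :
    (C.induce {i | Untouched (insert v T) i}).Preconnected := by
  have hset : {i | Untouched (insert v T) i} = (insert v.1 {i | ¬ Untouched T i})ᶜ := by
    ext i
    simp [untouched_insert, eq_comm]
  by_cases hvT : Untouched T v.1
  swap
  · have : {i | Untouched (insert v T) i} = {i | Untouched T i} := by
      ext i
      simp only [Set.mem_ofPred_eq, untouched_insert, and_iff_right_iff_imp]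
      rintro h rfl
      exact hvT h
    rwa [this]
  rcases hv with rfl | ⟨t, ht, htv⟩
  · have : {i | Untouched (insert v ∅) i} = ({v.1}ᶜ : Set ι) := by
      ext i
      simp [Untouched, eq_comm]
    rw [this]
    exact hdel _
  have htv := htv.resolve_left (hvT t ht)
  have hU' : (C.induce {i | ¬ Untouched T i}ᶜ).Preconnected := by
    have : {i | ¬ Untouched T i}ᶜ = {i | Untouched T i} := by
      ext i; simp
    rwa [this]
  by_cases hx : ∃ x, Untouched T x ∧ x ≠ v.1
  · obtain ⟨x, hx, hxv⟩ := hx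
    obtain ⟨y, z, hy, hz, hyv, hzv, hadj⟩ := exists_adj_of_preconnected hU {v.1} hvT hx rfl hxv
    rw [Set.mem_singleton_iff] at hyv
    subst hyv
    rw [hset]
    -- One of the at most two neighbours of `v.1` is touched, so `z` is its only untouched neighbour
    -- and trivially dominates it.
    refine preconnected_compl_insert_of_dominated hU' (v' := z) (by simpa using hz) hzv ?_
    intro j hj hvj
    left
    have hj : Untouched T j := by simpa using hj
    have hzt : z ≠ t.1 := fun h => hz t ht h.symm
    have hjt : j ≠ t.1 := fun h => hj t ht h.symm
    rcases hdeg _ _ _ _ htv hadj hvj with h | h | h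
    exacts [absurd h.symm hzt, absurd h.symm hjt, h.symm]
  · have : {i | Untouched (insert v T) i} = ∅ := by
      ext i
      simp only [Set.mem_ofPred_eq, untouched_insert, Set.mem_empty_iff_false, iff_false]
      rintro ⟨h1, h2⟩
      exact hx ⟨i, h2, h1.symm⟩
    rw [this]
    rintro ⟨x, hx⟩
    exact hx.elim

/-- The set is a union of whole cliques of even size. This parity guarantees Bob's waiting turns. -/
theorem even_card_touched [Fintype ι] (hq : Even q) (I : ι → Prop) [DecidablePred I] :
    Even (univ.filter fun p : Σ _ : ι, Fin q => I p.1).card := by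
  have : (univ.filter fun p : Σ _ : ι, Fin q => I p.1) =
      (univ.filter I).sigma fun _ => univ := by
    ext p; simp
  rw [this, card_sigma]
  simp [hq]

/-- The bookkeeping of Bob's strategy on a blown-up bipartite graph: all but one of the cliques
with weight have been opened by Bob at `f i`, or are far from the touched part. -/
def AlmostSafe (C : SimpleGraph ι) (W : ι → Prop) (f : ι → Σ _ : ι, Fin q)
    (T B : Finset (Σ _ : ι, Fin q)) : Prop :=
  ∃ b, ∀ i, W i → f i ∈ B ∨ (Untouched T i ∧ ∀ j, C.Adj i j → Untouched T j) ∨ i = b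

theorem AlmostSafe.mono {W : ι → Prop} {f : ι → Σ _ : ι, Fin q}
    {T T' B B' : Finset (Σ _ : ι, Fin q)} (h : AlmostSafe C W f T B)
    (hT : ∀ i, Untouched T i → Untouched T' i) (hB : B ⊆ B') : AlmostSafe C W f T' B' := by
  obtain ⟨b, hb⟩ := h
  exact ⟨b, fun i hi => (hb i hi).imp (fun h => hB h)
    (Or.imp (fun h => ⟨hT _ h.1, fun j hj => hT _ (h.2 j hj)⟩) id)⟩

/-- Remaining vertices of touched cliques are adjacent to taken twins, so rule (T) is harmless. The
untouched part is connected, so some remaining vertex outside it is not a cut vertex. -/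
theorem exists_legal_touched [Fintype ι] {g : Game} {T : Finset (Σ _ : ι, Fin q)} (hq0 : 0 < q)
    (hT : IsPosition g (blowUp C fun _ => q) T)
    (hU : (C.induce {i | Untouched T i}).Preconnected) (hv : ∃ v, v ∉ T ∧ ¬ Untouched T v.1) :
    ∃ v, ¬ Untouched T v.1 ∧
      Legal g (blowUp C fun _ => q) (T : Set (Σ _ : ι, Fin q)) v := by
  refine hT.exists_legal (preconnected_blowUp_fst (fun _ => hq0) hU) ?_ ?_ hv
  · intro p hp hpT
    exact hp p hpT rfl
  · intro v hvT hv
    obtain ⟨t, ht, htv⟩ := not_untouched.1 hv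
    exact ⟨t, ht, fun h => hvT (h ▸ ht), Or.inl htv.symm⟩

/-- As `q ≥ 2`, a twin remains in the same clique and keeps the rest connected. -/
theorem legal_of_untouched {g : Game} {T : Finset (Σ _ : ι, Fin q)} (hq : 2 ≤ q)
    (hT : IsPosition g (blowUp C fun _ => q) T)
    {p : Σ _ : ι, Fin q} (hp : Untouched T p.1) (hadj : T = ∅ ∨ ∃ t ∈ T, C.Adj p.1 t.1) :
    Legal g (blowUp C fun _ => q) (T : Set (Σ _ : ι, Fin q)) p := by
  have : Nontrivial (Fin q) := Fin.nontrivial_iff_two_le.2 hq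
  obtain ⟨z, hz⟩ := exists_ne p.2
  refine hT.legal_of_twin (p' := ⟨p.1, z⟩) (fun h => hp _ h rfl) (fun h => hp _ h rfl) ?_ rfl
    (hadj.imp id fun ⟨t, ht, hpt⟩ => ⟨t, ht, fun h => hp t ht (h ▸ rfl), Or.inr hpt⟩)
  rintro h
  rw [Sigma.ext_iff] at h
  exact hz (eq_of_heq h.2)

variable [DecidableEq ι] {W : ι → Prop} {f : ι → Σ _ : ι, Fin q}
  {T B : Finset (Σ _ : ι, Fin q)}

/-- If Alice opens a clique without weight, then Bob opens an untouched neighbouring one. -/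
theorem AlmostSafe.insert_insert (h : AlmostSafe C W f T B) (hf : ∀ i, (f i).1 = i)
    (hbip : ∀ i j, C.Adj i j → (W i ↔ ¬ W j))
    (hdeg : ∀ i x y z, C.Adj i x → C.Adj i y → C.Adj i z → x = y ∨ x = z ∨ y = z)
    {v : Σ _ : ι, Fin q} (hadj : T = ∅ ∨ ∃ t ∈ T, t.1 = v.1 ∨ C.Adj v.1 t.1)
    (hvU : Untouched T v.1) (hvW : ¬ W v.1) {e : ι} (hve : C.Adj v.1 e) (heU : Untouched T e) :
    AlmostSafe C W f (insert (f e) (insert v T)) (insert (f e) B) := by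
  have heW : W e := by
    by_contra h
    exact hvW ((hbip _ _ hve).2 h)
  -- Touching `v.1` endangers only its neighbours. In the first turn the neighbour other than `e`,
  -- if any, becomes the exceptional index. Later one neighbour of `v.1` is already touched, so `e`
  -- is the only safe index affected and the old exception is kept.
  obtain ⟨b', hb'⟩ : ∃ b', ∀ i, W i → f i ∈ B ∨
      (Untouched T i ∧ (∀ j, C.Adj i j → Untouched T j) ∧ (C.Adj v.1 i → i = e)) ∨ i = b' := by
    rcases hadj with rfl | ⟨t, ht, htv⟩
    · by_cases hx : ∃ x, C.Adj v.1 x ∧ x ≠ e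
      · obtain ⟨x, hx, hxe⟩ := hx
        refine ⟨x, fun i _ => Or.inr ?_⟩
        by_cases hi : i = x
        · exact Or.inr hi
        · refine Or.inl ⟨by simp [Untouched], by simp [Untouched], fun h => ?_⟩
          rcases hdeg _ _ _ _ h hx hve with h | h | h
          exacts [absurd h hi, h, absurd h hxe]
      · push Not at hx
        exact ⟨e, fun i _ => Or.inr (Or.inl ⟨by simp [Untouched], by simp [Untouched], hx i⟩)⟩
    · have htv := htv.resolve_left (hvU t ht)
      obtain ⟨b, hb⟩ := h
      refine ⟨b, fun i hi => (hb i hi).imp id (Or.imp (fun h => ⟨h.1, h.2, fun hvi => ?_⟩) id)⟩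
      rcases hdeg _ _ _ _ hvi htv hve with h' | h' | h'
      exacts [absurd h'.symm (h.1 t ht), h', absurd h' (heU t ht)]
  refine ⟨b', fun i hi => ?_⟩
  by_cases hie : i = e
  · subst hie
    exact Or.inl (mem_insert_self _ _)
  rcases hb' i hi with h | ⟨h1, h2, h3⟩ | h
  · exact Or.inl (mem_insert_of_mem h)
  · refine Or.inr (Or.inl ⟨?_, fun j hij => ?_⟩)
    · refine untouched_insert.2 ⟨by rw [hf]; exact Ne.symm hie, untouched_insert.2 ⟨?_, h1⟩⟩
      intro h
      exact hvW (h ▸ hi)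
    · refine untouched_insert.2 ⟨?_, untouched_insert.2 ⟨?_, h2 j hij⟩⟩
      · rw [hf]
        rintro rfl
        exact (hbip _ _ hij).1 hi heW
      · rintro h
        exact hie (h3 (h ▸ hij.symm))
  · exact Or.inr (Or.inr h)

/-- Other moves of Alice do not open further cliques with weight to her. -/
theorem AlmostSafe.insert_of_not_opening (h : AlmostSafe C W f T B)
    (hbip : ∀ i j, C.Adj i j → (W i ↔ ¬ W j))
    {v : Σ _ : ι, Fin q} (hadj : T = ∅ ∨ ∃ t ∈ T, t.1 = v.1 ∨ C.Adj v.1 t.1)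
    (hopen : ¬ (Untouched T v.1 ∧ ¬ W v.1 ∧ ∃ e, C.Adj v.1 e ∧ Untouched T e)) :
    AlmostSafe C W f (insert v T) B := by
  by_cases hvU : Untouched T v.1
  swap
  · exact h.mono (fun j hj => untouched_insert.2 ⟨fun h => hvU (h ▸ hj), hj⟩) subset_rfl
  obtain ⟨b, hb⟩ := h
  by_cases hvW : W v.1
  · have hsafe : ∀ i, W i → i ≠ v.1 → (Untouched T i ∧ ∀ j, C.Adj i j → Untouched T j) →
        Untouched (insert v T) i ∧ ∀ j, C.Adj i j → Untouched (insert v T) j := by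
      intro i hi hiv h
      refine ⟨untouched_insert.2 ⟨hiv.symm, h.1⟩, fun j hij =>
        untouched_insert.2 ⟨?_, h.2 j hij⟩⟩
      rintro rfl
      exact (hbip _ _ hij).1 hi hvW
    rcases hadj with rfl | ⟨t, ht, htv⟩
    -- Starting in a clique with weight uses up the single exception.
    · refine ⟨v.1, fun i hi => Or.inr ?_⟩
      by_cases hiv : i = v.1
      · exact Or.inr hiv
      · exact Or.inl (hsafe i hi hiv (by simp [Untouched]))
    · have htv := htv.resolve_left (hvU t ht)
      -- A safe clique has no touched neighbour, so rule (T) prevents Alice from entering it.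
      refine ⟨b, fun i hi => (hb i hi).imp id (Or.imp (fun h => ?_) id)⟩
      refine hsafe i hi ?_ h
      rintro rfl
      exact h.2 _ htv t ht rfl
  · have hnb : ∀ e, C.Adj v.1 e → ¬ Untouched T e := fun e he h => hopen ⟨hvU, hvW, e, he, h⟩
    refine ⟨b, fun i hi => (hb i hi).imp id (Or.imp (fun h => ?_) id)⟩
    refine ⟨untouched_insert.2 ⟨fun h => hvW (h ▸ hi), h.1⟩, fun j hij =>
      untouched_insert.2 ⟨?_, h.2 j hij⟩⟩
    rintro rfl
    exact hnb i hij.symm h.1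

/-- On the blow-up of a suitable bipartite graph with a vertex of weight `1` in each of the
cliques that replace one side, Bob secures all but one of the vertices of weight `1`. -/
theorem bobCanSecure_blowUp_of_bipartite [Fintype ι] [DecidablePred W]
    (hbip : ∀ i j, C.Adj i j → (W i ↔ ¬ W j))
    (hdeg : ∀ i x y z, C.Adj i x → C.Adj i y → C.Adj i z → x = y ∨ x = z ∨ y = z)
    (hdel : ∀ i, (C.induce {i}ᶜ).Preconnected) (hC : C.Connected) (hq : Even q) (hq0 : 0 < q)
    {g : Game} (hg : g.ruleT) {w : (Σ _ : ι, Fin q) → ℝ} (hw : ∀ v, 0 ≤ w v)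
    (hf : ∀ i, (f i).1 = i) (hw1 : ∀ i, W i → w (f i) = 1) :
    BobCanSecure g (blowUp C fun _ => q) w ((univ.filter W).card - 1) := by
  have hne : Nonempty ι := hC.nonempty
  have hVne : Nonempty (Σ _ : ι, Fin q) := hne.map fun i => ⟨i, ⟨0, hq0⟩⟩
  have hq2 : 2 ≤ q := by obtain ⟨r, rfl⟩ := hq; omega
  have hCu : (C.induce Set.univ).Preconnected :=
    (SimpleGraph.induceUnivIso C).preconnected_iff.2 hC.preconnected
  have hgain : ∀ (b : ι) (B : Finset (Σ _ : ι, Fin q)), (∀ i, W i → f i ∈ B ∨ i = b) →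
      ((univ.filter W).card - 1 : ℝ) ≤ ∑ v ∈ B, w v := by
    intro b B hB
    have h1 : ((univ.filter fun i : {i // W i} => i.1 ≠ b).card : ℝ) ≤ ∑ v ∈ B, w v := by
      refine card_le_sum_of_mem hw (f := fun i : {i // W i} => f i.1) ?_ ?_ _ ?_
      · intro i j h
        have := congrArg Sigma.fst h
        rw [hf, hf] at this
        exact Subtype.ext this
      · exact fun i => hw1 i.1 i.2
      · intro i hi
        exact (hB i.1 i.2).resolve_right (by simpa using hi)
    have h2 : (univ.filter W).card ≤ (univ.filter fun i : {i // W i} => i.1 ≠ b).card + 1 := by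
      calc (univ.filter W).card
          ≤ (insert b ((univ.filter fun i : {i // W i} => i.1 ≠ b).image Subtype.val)).card := by
            refine card_le_card fun i hi => ?_
            by_cases hib : i = b
            · simp [hib]
            · simpa [hib] using hi
        _ ≤ _ := (card_insert_le _ _).trans (Nat.add_le_add_right card_image_le 1)
    have h3 : ((univ.filter W).card : ℝ) ≤
        (univ.filter fun i : {i // W i} => i.1 ≠ b).card + 1 := by exact_mod_cast h2
    linarith
  refine bobCanSecure_of_invariant hw (fun T B => Even T.card ∧
    IsPosition g (blowUp C fun _ => q) T ∧ (C.induce {i | Untouched T i}).Preconnected ∧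
    AlmostSafe C W f T B) ?_ ?_ ?_
  · have h1 : {i | Untouched (∅ : Finset (Σ _ : ι, Fin q)) i} = Set.univ := by
      ext i; simp [Untouched]
    have h2 : (blowUp C fun _ => q).Preconnected := by
      have := preconnected_blowUp_fst (fun _ => hq0) hCu (s := fun _ => q)
      exact (SimpleGraph.induceUnivIso _).preconnected_iff.1 this
    refine ⟨by simp, isPosition_empty h2, by rwa [h1], hne.some, fun i _ => Or.inr (Or.inl ?_)⟩
    simp [Untouched]
  · rintro T B ⟨-, hT, hU, b, hb⟩
    rcases T.eq_empty_or_nonempty with rfl | hTne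
    · exact Or.inr ⟨⟨hne.some, ⟨0, hq0⟩⟩,
        legal_of_untouched hq2 hT (by simp [Untouched]) (Or.inl rfl)⟩
    by_cases hr : ∃ v, v ∉ T ∧ ¬ Untouched T v.1
    · obtain ⟨v, -, hv⟩ := exists_legal_touched hq0 hT hU hr
      exact Or.inr ⟨v, hv⟩
    by_cases hi : ∃ i, Untouched T i
    · right
      obtain ⟨i, hi⟩ := hi
      obtain ⟨t, ht⟩ := hTne
      obtain ⟨x, y, -, -, hx, hy, hxy⟩ := exists_adj_of_preconnected hCu {i | Untouched T i}
        (Set.mem_univ i) (Set.mem_univ t.1) hi (fun h => h t ht rfl)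
      obtain ⟨s, hs, rfl⟩ := not_untouched.1 hy
      exact ⟨⟨x, ⟨0, hq0⟩⟩, legal_of_untouched hq2 hT hx (Or.inr ⟨s, hs, hxy⟩)⟩
    -- All cliques are touched, so none is still safe: each one with weight is Bob's or the
    -- exception.
    · left
      refine hgain b B fun i hi' => (hb i hi').imp id fun h => ?_
      exact h.resolve_left fun h => hi ⟨i, h.1⟩
  · rintro T B ⟨heven, hT, hU, hB⟩ v hv
    right
    have hvT : v ∉ T := hv.1
    have hadj : T = ∅ ∨ ∃ t ∈ T, t.1 = v.1 ∨ C.Adj v.1 t.1 := by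
      rcases T.eq_empty_or_nonempty with rfl | hTne
      · exact Or.inl rfl
      · obtain ⟨t, ht, hvt⟩ := hv.exists_adj hg hTne
        exact Or.inr ⟨t, ht, hvt.2.imp Eq.symm id⟩
    have hT1 := IsPosition.insert hg hv
    have hU1 := preconnected_untouched_insert hdeg hdel hU hadj
    have hodd : ¬ Even (insert v T).card := by
      rw [card_insert_of_notMem hvT]
      exact Nat.not_even_iff_odd.2 heven.add_one
    have hfinish : ∀ u, Legal g (blowUp C fun _ => q)
        ((insert v T : Finset (Σ _ : ι, Fin q)) : Set (Σ _ : ι, Fin q)) u →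
        (∃ t ∈ insert v T, t.1 = u.1 ∨ C.Adj u.1 t.1) →
        Even (insert u (insert v T)).card ∧
          IsPosition g (blowUp C fun _ => q) (insert u (insert v T)) ∧
          (C.induce {i | Untouched (insert u (insert v T)) i}).Preconnected := by
      intro u hu hadj
      refine ⟨?_, IsPosition.insert hg hu, preconnected_untouched_insert hdeg hdel hU1 (Or.inr hadj)⟩
      have : u ∉ insert v T := hu.1
      rw [card_insert_of_notMem this]
      exact Nat.even_add_one.2 hodd
    by_cases hopen : Untouched T v.1 ∧ ¬ W v.1 ∧ ∃ e, C.Adj v.1 e ∧ Untouched T e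
    · obtain ⟨hvU, hvW, e, hve, heU⟩ := hopen
      have heU1 : Untouched (insert v T) (f e).1 := by
        rw [hf]; exact untouched_insert.2 ⟨hve.ne, heU⟩
      have hev : ∃ t ∈ insert v T, C.Adj (f e).1 t.1 :=
        ⟨v, mem_insert_self _ _, by rw [hf]; exact hve.symm⟩
      have hl := legal_of_untouched hq2 hT1 heU1 (Or.inr hev)
      obtain ⟨h1, h2, h3⟩ := hfinish _ hl (by obtain ⟨t, ht, h⟩ := hev; exact ⟨t, ht, Or.inr h⟩)
      exact ⟨f e, hl, h1, h2, h3, hB.insert_insert hf hbip hdeg hadj hvU hvW hve heU⟩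
    -- If the touched cliques were exhausted, an even number of vertices would be taken. Hence Bob
    -- has a waiting turn, and it touches no new clique.
    · have hB1 := hB.insert_of_not_opening hbip hadj hopen
      obtain ⟨u, huU, hu⟩ := exists_legal_touched hq0 hT1 hU1 (by
        by_contra hcon
        push Not at hcon
        classical
        refine hodd ?_
        have : insert v T = univ.filter fun p : Σ _ : ι, Fin q => ¬ Untouched (insert v T) p.1 := by
          ext p
          simp only [mem_filter, mem_univ, true_and]
          exact ⟨fun hp h => h p hp rfl, fun h => by
            by_contra hp
            exact h (hcon p hp)⟩
        rw [this]
        exact even_card_touched hq fun i => ¬ Untouched (insert v T) i)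
      obtain ⟨t, ht, htu⟩ := not_untouched.1 huU
      obtain ⟨h1, h2, h3⟩ := hfinish u hu ⟨t, ht, Or.inl htu⟩
      exact ⟨u, hu, h1, h2, h3, hB1.mono
        (fun j hj => untouched_insert.2 ⟨fun h => huU (h ▸ hj), hj⟩) (subset_insert _ _)⟩

/-- If removing one vertex does not disconnect `C`, then the blow-up of `C` with cliques of `q`
vertices is `2 * q`-connected. -/
theorem isKConnected_blowUp [Fintype ι] (hdel : ∀ i, (C.induce {i}ᶜ).Preconnected) (hC : C.Connected)
    (hcard : 2 < Fintype.card ι) (hq : 0 < q) {k : ℕ} (hk : k ≤ 2 * q) :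
    IsKConnected (blowUp C fun _ => q) k := by
  constructor
  · rw [Fintype.card_sigma]
    simp only [Fintype.card_fin, sum_const, card_univ, smul_eq_mul]
    nlinarith
  intro S hS
  have hfull : ∀ i j, i ≠ j → (∀ z, (⟨i, z⟩ : Σ _ : ι, Fin q) ∈ S) →
      (∀ z, (⟨j, z⟩ : Σ _ : ι, Fin q) ∈ S) → False := by
    intro i j hij hi hj
    have : (({i, j} : Finset ι).sigma fun _ => (univ : Finset (Fin q))) ⊆ S := by
      rintro ⟨x, z⟩ hx
      rcases (by simpa using hx : x = i ∨ x = j) with rfl | rfl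
      · exact hi z
      · exact hj z
    have := card_le_card this
    rw [card_sigma] at this
    simp [card_pair hij] at this
    omega
  have hpre : (C.induce (Sigma.fst '' ((S : Set (Σ _ : ι, Fin q))ᶜ))).Preconnected := by
    by_cases h : ∃ i, ∀ z, (⟨i, z⟩ : Σ _ : ι, Fin q) ∈ S
    · obtain ⟨i, hi⟩ := h
      have : Sigma.fst '' ((S : Set (Σ _ : ι, Fin q))ᶜ) = ({i}ᶜ : Set ι) := by
        ext j
        constructor
        · rintro ⟨p, hp, rfl⟩ rfl
          exact hp (hi p.2)
        · intro hj
          by_contra hcon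
          refine hfull j i hj (fun z => ?_) hi
          by_contra hz
          exact hcon ⟨⟨j, z⟩, hz, rfl⟩
      rw [this]
      exact hdel i
    · have : Sigma.fst '' ((S : Set (Σ _ : ι, Fin q))ᶜ) = Set.univ := by
        ext j
        simp only [Set.mem_univ, iff_true]
        push Not at h
        obtain ⟨z, hz⟩ := h j
        exact ⟨⟨j, z⟩, hz, rfl⟩
      rw [this]
      exact ((SimpleGraph.induceUnivIso C).connected_iff.2 hC).preconnected
  refine connected_iff_preconnected.2 ⟨preconnected_blowUp hpre, ?_⟩
  by_contra hempty
  rw [Set.not_nonempty_iff_eq_empty, Set.compl_empty_iff] at hempty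
  obtain ⟨i, j, hij⟩ := Fintype.one_lt_card_iff.1 (by omega : 1 < Fintype.card ι)
  refine hfull i j hij (fun z => ?_) (fun z => ?_)
  · rw [← mem_coe, hempty]; trivial
  · rw [← mem_coe, hempty]; trivial

theorem cycleGraph_adj_iff_val {N : ℕ} (hN : 3 ≤ N) {u v : Fin N} :
    (SimpleGraph.cycleGraph N).Adj u v ↔ u.val + 1 = v.val ∨ v.val + 1 = u.val ∨
      (u.val = 0 ∧ v.val + 1 = N) ∨ (v.val = 0 ∧ u.val + 1 = N) := by
  rw [SimpleGraph.cycleGraph_adj']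
  have hu := u.2
  have hv := v.2
  rcases lt_trichotomy u.val v.val with h | h | h
  · rw [Fin.coe_sub_iff_lt.2 h, Fin.coe_sub_iff_le.2 h.le]
    omega
  · obtain rfl := Fin.ext h
    rw [Fin.coe_sub_iff_le.2 le_rfl]
    omega
  · rw [Fin.coe_sub_iff_le.2 h.le, Fin.coe_sub_iff_lt.2 h]
    omega

theorem preconnected_cycleGraph_compl_singleton {N : ℕ} (hN : 3 ≤ N) (i : Fin N) :
    ((SimpleGraph.cycleGraph N).induce ({i}ᶜ : Set (Fin N))).Preconnected := by
  set H := (SimpleGraph.cycleGraph N).induce ({i}ᶜ : Set (Fin N)) with hH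
  have hmem : ∀ {j : ℕ} (hj : j < N), j ≠ i.val → (⟨j, hj⟩ : Fin N) ∈ ({i}ᶜ : Set (Fin N)) :=
    fun hj h e => h (congrArg Fin.val e)
  have hadj : ∀ {a b : ℕ} (ha : a < N) (hb : b < N) (hai : a ≠ i.val) (hbi : b ≠ i.val),
      (a + 1 = b ∨ b + 1 = a ∨ (a = 0 ∧ b + 1 = N) ∨ (b = 0 ∧ a + 1 = N)) →
      H.Reachable ⟨⟨a, ha⟩, hmem ha hai⟩ ⟨⟨b, hb⟩, hmem hb hbi⟩ := fun ha hb hai hbi h =>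
    SimpleGraph.Adj.reachable ((cycleGraph_adj_iff_val hN).2 h)
  have hlow : ∀ (j : ℕ) (hj : j < N) (hji : j < i.val),
      H.Reachable ⟨⟨j, hj⟩, hmem hj hji.ne⟩
        ⟨⟨0, by omega⟩, hmem (by omega) (by omega)⟩ := by
    intro j
    induction j with
    | zero => exact fun _ _ => .refl _
    | succ j ih =>
      intro hj hji
      exact (hadj hj (by omega) hji.ne (by omega) (by omega)).trans (ih (by omega) (by omega))
  have hhigh : ∀ (d j : ℕ) (hj : j < N) (hji : i.val < j), j + d + 1 = N →
      H.Reachable ⟨⟨j, hj⟩, hmem hj hji.ne'⟩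
        ⟨⟨N - 1, by omega⟩, hmem (by omega) (by omega)⟩ := by
    intro d
    induction d with
    | zero =>
      intro j hj hji h
      obtain rfl : j = N - 1 := by omega
      exact .refl _
    | succ d ih =>
      intro j hj hji h
      exact (hadj hj (by omega) hji.ne' (by omega) (by omega)).trans
        (ih (j + 1) (by omega) (by omega) (by omega))
  have hi := i.2
  -- If `i` is the last vertex, the arc below it is everything. Otherwise the arcs below and above
  -- `i` are joined by the edge between `0` and `N - 1`.
  by_cases hlast : i.val + 1 = N
  · refine preconnected_of_forall_reachable
      ⟨⟨0, by omega⟩, hmem (by omega) (by omega)⟩ ?_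
    rintro ⟨j, hj⟩
    have hji : j.val ≠ i.val := fun h => hj (Fin.ext h)
    exact hlow j.val j.2 (by omega)
  · refine preconnected_of_forall_reachable
      ⟨⟨N - 1, by omega⟩, hmem (by omega) (by omega)⟩ ?_
    rintro ⟨j, hj⟩
    have hji : j.val ≠ i.val := fun h => hj (Fin.ext h)
    rcases lt_or_gt_of_ne hji with h | h
    · exact (hlow j.val j.2 h).trans
        (hadj (by omega) (by omega) (by omega) (by omega) (by omega))
    · exact hhigh (N - 1 - j.val) j.val j.2 h (by omega)

end Cycle

/-! ### The blown-up even cycle. -/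

theorem even_card_cycleVertex (n k : ℕ) : Even (Fintype.card (CycleVertex n k)) := by
  rw [Fintype.card_sigma]
  simp

theorem isKConnected_cycleBlowUp {n k : ℕ} (hn : 2 ≤ n) (hk : 1 ≤ k) :
    IsKConnected (cycleBlowUp n k) k := by
  have h4 : k ≤ 4 * (k ⌈/⌉ 4) := by
    rw [Nat.ceilDiv_eq_add_pred_div]; omega
  obtain ⟨N, hN⟩ : ∃ N, 2 * n = N + 1 := ⟨2 * n - 1, by omega⟩
  refine isKConnected_blowUp (preconnected_cycleGraph_compl_singleton (by omega)) ?_ ?_ ?_ ?_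
  · rw [hN]; exact SimpleGraph.cycleGraph_connected
  · rw [Fintype.card_fin]; omega
  · omega
  · omega

theorem card_filter_even_fin (n : ℕ) :
    (univ.filter fun i : Fin (2 * n) => Even i.val).card = n := by
  have : (univ.filter fun i : Fin (2 * n) => Even i.val) =
      (univ : Finset (Fin n)).image fun j => ⟨2 * j.val, by omega⟩ := by
    ext i
    simp only [mem_filter, mem_univ, true_and, mem_image, Fin.ext_iff]
    constructor
    · rintro ⟨r, hr⟩
      exact ⟨⟨r, by omega⟩, by simp; omega⟩
    · rintro ⟨j, hj⟩
      exact ⟨j.val, by omega⟩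
  rw [this, card_image_of_injective _ fun a b h => ?_, card_univ, Fintype.card_fin]
  have := congrArg Fin.val h
  exact Fin.ext (by simpa using this)

theorem sum_cycleWeight {n k : ℕ} (hk : 1 ≤ k) : ∑ p, cycleWeight n k p = n := by
  have h0 : 0 < 2 * (k ⌈/⌉ 4) := by rw [Nat.ceilDiv_eq_add_pred_div]; omega
  rw [Fintype.sum_sigma]
  have : ∀ i : Fin (2 * n), ∑ z, cycleWeight n k ⟨i, z⟩ = if Even i.val then 1 else 0 := by
    intro i
    rw [sum_eq_single (⟨0, h0⟩ : Fin (2 * (k ⌈/⌉ 4)))]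
    · simp [cycleWeight]
    · intro z _ hz
      have : z.val ≠ 0 := fun h => hz (Fin.ext h)
      simp [cycleWeight, this]
    · simp
  simp only [this]
  rw [sum_boole, card_filter_even_fin]

theorem bobGetsAlmostAll_cycleBlowUp {n k : ℕ} (hn : 2 ≤ n) (hk : 1 ≤ k) {ε : ℝ}
    (hε : 1 ≤ ε * n) {g : Game} (hg : g.ruleT) :
    BobGetsAlmostAll g (cycleBlowUp n k) (cycleWeight n k) ε := by
  have h0 : 0 < 2 * (k ⌈/⌉ 4) := by rw [Nat.ceilDiv_eq_add_pred_div]; omega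
  have hw : ∀ p, 0 ≤ cycleWeight n k p := fun p => by
    unfold cycleWeight; split_ifs <;> norm_num
  have hN : 3 ≤ 2 * n := by omega
  refine ⟨hw, ?_, ?_⟩
  · rw [sum_cycleWeight hk]
    exact_mod_cast (by omega : 0 < n)
  have := bobCanSecure_blowUp_of_bipartite (C := SimpleGraph.cycleGraph (2 * n))
    (q := 2 * (k ⌈/⌉ 4)) (W := fun i => Even i.val) (f := fun i => ⟨i, ⟨0, h0⟩⟩)
    (w := cycleWeight n k) ?_ ?_ (preconnected_cycleGraph_compl_singleton hN) ?_
    (even_two_mul _) h0 hg hw (fun _ => rfl) ?_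
  · rw [card_filter_even_fin] at this
    refine this.mono ?_
    rw [sum_cycleWeight hk]
    linarith
  · intro i j hij
    have := i.2
    have := j.2
    rw [cycleGraph_adj_iff_val hN] at hij
    simp only [Nat.even_iff]
    omega
  · intro i x y z hx hy hz
    rw [cycleGraph_adj_iff_val hN] at hx hy hz
    simp only [Fin.ext_iff]
    omega
  · obtain ⟨N, hN⟩ : ∃ N, 2 * n = N + 1 := ⟨2 * n - 1, by omega⟩
    rw [hN]; exact SimpleGraph.cycleGraph_connected
  · intro i hi
    have : Even i.val := hi
    simp [cycleWeight, this]

/-! ### Games T and TR on the blown-up Micek–Walczak graph. -/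

section MicekWalczak

variable {n k : ℕ}

theorem mwGraph_adj_inl {i : Fin n} {v : MWVertex n} :
    (mwGraph n).Adj (.inl i) v ↔ v = .inr (.inl i) := by
  rcases v with j | j | S <;> simp [mwGraph, eq_comm]

theorem mwGraph_adj_inr_inl {i : Fin n} {v : MWVertex n} :
    (mwGraph n).Adj (.inr (.inl i)) v ↔
      v = .inl i ∨ ∃ S : {S : Finset (Fin n) // S.Nonempty}, i ∈ S.1 ∧ v = .inr (.inr S) := by
  rcases v with j | j | S <;> simp [mwGraph]

theorem mwGraph_adj_inr_inr {S : {S : Finset (Fin n) // S.Nonempty}} {v : MWVertex n} :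
    (mwGraph n).Adj (.inr (.inr S)) v ↔ ∃ i ∈ S.1, v = .inr (.inl i) := by
  rcases v with j | j | S <;> simp [mwGraph]

/-- An induced subgraph of the Micek–Walczak graph is connected if all its vertices can reach a
vertex `c S` in it. -/
theorem preconnected_mwGraph {R : Set (MWVertex n)} {S : {S : Finset (Fin n) // S.Nonempty}}
    (hS : .inr (.inr S) ∈ R) (ha : ∀ i, .inl i ∈ R → .inr (.inl i) ∈ R)
    (hb : ∀ i, .inr (.inl i) ∈ R → i ∈ S.1)
    (hc : ∀ S', .inr (.inr S') ∈ R → ∃ i ∈ S'.1, .inr (.inl i) ∈ R) :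
    ((mwGraph n).induce R).Preconnected := by
  have hb' : ∀ i (hi : .inr (.inl i) ∈ R),
      ((mwGraph n).induce R).Reachable ⟨.inr (.inl i), hi⟩ ⟨.inr (.inr S), hS⟩ := fun i hi =>
    SimpleGraph.Adj.reachable
      (mwGraph_adj_inr_inl.2 (Or.inr ⟨S, hb i hi, rfl⟩) : (mwGraph n).Adj _ _)
  refine preconnected_of_forall_reachable ⟨.inr (.inr S), hS⟩ ?_
  rintro ⟨i | i | S', hR⟩
  · refine .trans (SimpleGraph.Adj.reachable ?_) (hb' i (ha i hR))
    exact (mwGraph_adj_inl.2 rfl : (mwGraph n).Adj _ _)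
  · exact hb' i hR
  · obtain ⟨i, hi, hiR⟩ := hc S' hR
    refine .trans (SimpleGraph.Adj.reachable ?_) (hb' i hiR)
    exact (mwGraph_adj_inr_inr.2 ⟨i, hi, rfl⟩ : (mwGraph n).Adj _ _)

/-- The vertices of the blow-up of the Micek–Walczak graph. -/
abbrev MWBlowUpVertex (n k : ℕ) : Type := Σ v : MWVertex n, Fin (mwSize n k v)

/-- The vertex `a i` of the blow-up. -/
def mwA (k : ℕ) (i : Fin n) : MWBlowUpVertex n k := ⟨.inl i, ⟨0, Nat.one_pos⟩⟩

/-- The vertices of the clique that replaces `b i`. -/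
def mwB (i : Fin n) (z : Fin (2 * k + 1)) : MWBlowUpVertex n k := ⟨.inr (.inl i), z⟩

theorem eq_mwA {p : MWBlowUpVertex n k} {i : Fin n} (h : p.1 = .inl i) : p = mwA k i := by
  obtain ⟨v, z⟩ := p
  obtain rfl : v = .inl i := h
  have hz : z.val < 1 := z.2
  exact Sigma.ext rfl (heq_of_eq (Fin.ext (by change z.val = 0; omega)))

theorem mwA_injective : Function.Injective (mwA (n := n) k) := fun _ _ h =>
  Sum.inl_injective (congrArg Sigma.fst h)

theorem mwB_injective (i : Fin n) : Function.Injective (mwB (k := k) i) := fun _ _ h =>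
  eq_of_heq (Sigma.ext_iff.1 h).2

theorem mwSize_pos (v : MWVertex n) : 0 < mwSize n k v := by
  rcases v with i | v
  · exact Nat.one_pos
  · exact Nat.succ_pos _

theorem mwBlowUp_adj_mwA_mwB {i : Fin n} {z : Fin (2 * k + 1)} :
    (mwBlowUp n k).Adj (mwA k i) (mwB i z) :=
  ⟨by simp [mwA, mwB, Sigma.ext_iff], Or.inr (mwGraph_adj_inl.2 rfl)⟩

theorem fst_of_mwBlowUp_adj_mwA {i : Fin n} {p : MWBlowUpVertex n k}
    (h : (mwBlowUp n k).Adj (mwA k i) p) : p.1 = .inr (.inl i) := by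
  rcases h.2 with h' | h'
  · exact absurd (eq_mwA h'.symm).symm h.1
  · exact mwGraph_adj_inl.1 h'

/-- The clique that replaces `b i` contains a taken vertex. -/
def Opened (T : Finset (MWBlowUpVertex n k)) (i : Fin n) : Prop := ∃ p ∈ T, p.1 = .inr (.inl i)

/-- The part of the graph next to the vertices `b i` with `i ∈ I`. -/
def InRegion (I : Fin n → Prop) : MWVertex n → Prop
  | .inl i => I i
  | .inr (.inl i) => I i
  | .inr (.inr S) => ∃ i ∈ S.1, I i

theorem InRegion.mono {I J : Fin n → Prop} (h : ∀ i, I i → J i) {v : MWVertex n}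
    (hv : InRegion I v) : InRegion J v := by
  rcases v with i | i | S
  · exact h i hv
  · exact h i hv
  · obtain ⟨i, hi, hI⟩ := hv
    exact ⟨i, hi, h i hI⟩

-- Each index in `I` contributes `1 + (2 * k + 1)` vertices. The number of sets meeting `I` is `2 ^
-- n` minus the number of subsets of the complement of `I`; both are even because `j` lies in that
-- complement.
open Classical in
theorem even_card_inRegion {I : Fin n → Prop} {j : Fin n} (hj : ¬ I j) :
    Even (univ.filter fun p : MWBlowUpVertex n k => InRegion I p.1).card := by
  have h1 : (univ.filter fun p : MWBlowUpVertex n k => InRegion I p.1) =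
      (univ.filter fun v => InRegion I v).sigma fun _ => univ := by
    ext p; simp
  have h2 : Even (univ.filter fun S : {S : Finset (Fin n) // S.Nonempty} =>
      ∃ i ∈ S.1, I i).card := by
    have h3 : (univ.filter fun S : {S : Finset (Fin n) // S.Nonempty} => ∃ i ∈ S.1, I i).card =
        (univ \ (univ.filter fun i => ¬ I i).powerset : Finset (Finset (Fin n))).card := by
      rw [← card_map (Function.Embedding.subtype _)]
      congr 1
      ext S
      simp only [mem_map, mem_filter, mem_univ, true_and, Function.Embedding.subtype_apply,
        Subtype.exists, exists_and_right, exists_eq_right, mem_sdiff, mem_powerset, subset_iff]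
      constructor
      · rintro ⟨-, i, hi, hI⟩ h
        exact h hi hI
      · intro h
        push Not at h
        obtain ⟨i, hi, hI⟩ := h
        exact ⟨⟨i, hi⟩, i, hi, hI⟩
    rw [h3, card_sdiff_of_subset (subset_univ _), card_powerset, card_univ, Fintype.card_finset,
      Fintype.card_fin]
    refine (Nat.even_sub (Nat.pow_le_pow_right two_pos ?_)).2 (iff_of_true ?_ ?_)
    · exact (card_le_univ _).trans (by simp)
    · exact (even_two.pow_of_ne_zero (by have := j.2; omega))
    · exact even_two.pow_of_ne_zero (card_pos.2 ⟨j, by simpa using hj⟩).ne'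
  simp only [h1, card_sigma, card_univ, Fintype.card_fin]
  rw [sum_filter, Fintype.sum_sum_type, Fintype.sum_sum_type]
  rw [← add_assoc, ← sum_add_distrib]
  refine Even.add (even_sum _ fun i _ => ?_) ?_
  · by_cases hi : I i
    · exact ⟨k + 1, by simp only [InRegion, hi, if_true, mwSize]; ring⟩
    · simp [InRegion, hi]
  · rw [card_filter] at h2
    have h3 := h2.mul_right (2 * k + 1)
    rw [sum_mul] at h3
    refine (congrArg Even ?_).mpr h3
    refine sum_congr rfl fun S _ => ?_
    by_cases hS : ∃ i ∈ S.1, I i <;> simp [InRegion, hS, mwSize]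

/-- The vertex `c S` for `S` the complement of `I` lies outside the region and is joined to every `b
i` there, so it is a hub. -/
theorem preconnected_not_inRegion {I : Fin n → Prop} {j : Fin n} (hj : ¬ I j) :
    ((mwBlowUp n k).induce {p | ¬ InRegion I p.1}).Preconnected := by
  classical
  refine preconnected_blowUp_fst (I := {v | ¬ InRegion I v}) mwSize_pos ?_
  refine preconnected_mwGraph (S := ⟨univ.filter fun i => ¬ I i, j, by simpa using hj⟩)
    ?_ (fun i h => h) ?_ ?_
  · rintro ⟨i, hi, hI⟩
    exact (mem_filter.1 hi).2 hI
  · intro i hi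
    exact mem_filter.2 ⟨mem_univ _, hi⟩
  · intro S hS
    obtain ⟨i, hi⟩ := S.2
    exact ⟨i, hi, fun h => hS ⟨i, hi, h⟩⟩

theorem preconnected_mwGraph_univ (hn : 0 < n) : (mwGraph n).Preconnected := by
  have : ((mwGraph n).induce Set.univ).Preconnected :=
    preconnected_mwGraph (S := ⟨univ, ⟨0, hn⟩, mem_univ _⟩) (Set.mem_univ _) (fun _ _ => trivial)
      (fun _ _ => mem_univ _) fun S _ => by
        obtain ⟨i, hi⟩ := S.2
        exact ⟨i, hi, trivial⟩
  exact (SimpleGraph.induceUnivIso _).preconnected_iff.1 this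

theorem preconnected_mwBlowUp (hn : 0 < n) : (mwBlowUp n k).Preconnected := by
  have := preconnected_blowUp_fst (s := mwSize n k) (G := mwGraph n) mwSize_pos
    ((SimpleGraph.induceUnivIso _).preconnected_iff.2 (preconnected_mwGraph_univ hn))
  exact (SimpleGraph.induceUnivIso _).preconnected_iff.1 this

/-- Fewer than `2 * k + 1` deletions empty no weightless clique, and the clique of `c univ` then
serves as a hub. -/
theorem isKConnected_mwBlowUp (hn : 0 < n) : IsKConnected (mwBlowUp n k) (2 * k + 1) := by
  have hS0 : (univ : Finset (Fin n)).Nonempty := ⟨⟨0, hn⟩, mem_univ _⟩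
  have hclique : ∀ (F : Finset (MWBlowUpVertex n k)) (v : Fin n ⊕ {S : Finset (Fin n) // S.Nonempty}),
      F.card < 2 * k + 1 → ∃ z, (⟨.inr v, z⟩ : MWBlowUpVertex n k) ∉ F := by
    intro F v hF
    by_contra hcon
    push Not at hcon
    have hinj : Function.Injective
        fun z : Fin (2 * k + 1) => (⟨.inr v, z⟩ : MWBlowUpVertex n k) :=
      fun _ _ h => eq_of_heq (Sigma.ext_iff.1 h).2
    have := card_le_card (image_subset_iff.2 fun z _ => hcon z : univ.image
      (fun z : Fin (2 * k + 1) => (⟨.inr v, z⟩ : MWBlowUpVertex n k)) ⊆ F)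
    rw [card_image_of_injective _ hinj, card_univ, Fintype.card_fin] at this
    omega
  constructor
  · by_contra hcon
    push Not at hcon
    change Fintype.card (MWBlowUpVertex n k) ≤ _ at hcon
    -- If there were too few vertices, deleting all but one `a i` would be a small deletion, yet it
    -- empties the clique of a `b i`.
    have h1 : (univ.erase (mwA k ⟨0, hn⟩ : MWBlowUpVertex n k)).card < 2 * k + 1 := by
      rw [card_erase_of_mem (mem_univ _), card_univ]
      have : 0 < Fintype.card (MWBlowUpVertex n k) := Fintype.card_pos_iff.2 ⟨mwA k ⟨0, hn⟩⟩
      omega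
    obtain ⟨z, hz⟩ := hclique _ (.inl ⟨0, hn⟩) h1
    exact hz (mem_erase.2 ⟨by simp [mwA, Sigma.ext_iff], mem_univ _⟩)
  intro F hF
  have hproj : ∀ v, .inr v ∈ Sigma.fst '' ((F : Set (MWBlowUpVertex n k))ᶜ) := fun v => by
    obtain ⟨z, hz⟩ := hclique F v hF
    exact ⟨_, hz, rfl⟩
  refine connected_iff_preconnected.2 ⟨preconnected_blowUp ?_, ?_⟩
  · exact preconnected_mwGraph (S := ⟨univ, hS0⟩) (hproj _) (fun _ _ => hproj _)
      (fun _ _ => mem_univ _) fun S _ => by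
        obtain ⟨i, hi⟩ := S.2
        exact ⟨i, hi, hproj _⟩
  · obtain ⟨z, hz⟩ := hclique F (.inl ⟨0, hn⟩) hF
    exact ⟨_, hz⟩

theorem odd_card_mwBlowUpVertex (hn : 0 < n) : Odd (Fintype.card (MWBlowUpVertex n k)) := by
  have h1 : Odd (Fintype.card {S : Finset (Fin n) // S.Nonempty}) := by
    have : Fintype.card {S : Finset (Fin n) // S.Nonempty} = 2 ^ n - 1 := by
      have h := Fintype.card_subtype_compl (fun S : Finset (Fin n) => S = ∅)
      simp only [Fintype.card_finset, Fintype.card_fin, Fintype.card_unique] at h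
      rw [← h]
      exact Fintype.card_congr (Equiv.subtypeEquivRight fun S => nonempty_iff_ne_empty)
    rw [this]
    exact Nat.Even.sub_odd Nat.one_le_two_pow (even_two.pow_of_ne_zero hn.ne') odd_one
  simp only [Fintype.card_sigma, Fintype.card_fin]
  rw [Fintype.sum_sum_type, Fintype.sum_sum_type]
  simp only [mwSize, sum_const, card_univ, Fintype.card_fin, smul_eq_mul]
  rw [← add_assoc]
  exact Even.add_odd ⟨n * (k + 1), by ring⟩ (h1.mul ⟨k, rfl⟩)

theorem sum_mwWeight : ∑ p, mwWeight n k p = n := by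
  rw [Fintype.sum_sigma, Fintype.sum_sum_type, Fintype.sum_sum_type]
  simp only [mwWeight, sum_const, card_univ, Fintype.card_fin]
  simp [mwSize]

theorem opened_insert {T : Finset (MWBlowUpVertex n k)} {v : MWBlowUpVertex n k} {i : Fin n} :
    Opened (insert v T) i ↔ v.1 = .inr (.inl i) ∨ Opened T i := by
  simp [Opened]

/-- All but one of the opened vertices `a i` have been taken by Bob. -/
def AlmostAllOpened (T B : Finset (MWBlowUpVertex n k)) : Prop :=
  ∃ b, ∀ i, Opened T i → mwA k i ∈ B ∨ i = b

/-- The positions that Bob can maintain after his moves. -/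
structure MWInvariant (g : Game) (T B : Finset (MWBlowUpVertex n k)) : Prop where
  even : Even T.card
  position : IsPosition g (mwBlowUp n k) T
  exists_opened : T.Nonempty → ∃ i, Opened T i
  inRegion : ∀ p ∈ T, InRegion (Opened T) p.1
  almostAll : AlmostAllOpened T B

/-- Every remaining vertex of the region has a taken neighbour in an opened clique, and the outside
of the region is connected, so a non-cut vertex can be chosen inside. -/
theorem exists_legal_inRegion {g : Game} {T : Finset (MWBlowUpVertex n k)}
    (hT : IsPosition g (mwBlowUp n k) T) {j : Fin n} (hj : ¬ Opened T j)
    (hreg : ∀ p ∈ T, InRegion (Opened T) p.1)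
    (hne : ∃ v, v ∉ T ∧ InRegion (Opened T) v.1) :
    ∃ v : MWBlowUpVertex n k, InRegion (Opened T) v.1 ∧
      Legal g (mwBlowUp n k) (T : Set (MWBlowUpVertex n k)) v := by
  have hadj : ∀ v, v ∉ T → v ∉ {p : MWBlowUpVertex n k | ¬ InRegion (Opened T) p.1} →
      ∃ t ∈ T, (mwBlowUp n k).Adj v t := by
    intro v hvT hv
    have hv : InRegion (Opened T) v.1 := not_not.1 hv
    obtain ⟨i | i | S, z⟩ := v
    · obtain ⟨t, ht, hti⟩ := hv
      exact ⟨t, ht, fun h => hvT (h ▸ ht), Or.inr (mwGraph_adj_inl.2 hti)⟩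
    · obtain ⟨t, ht, hti⟩ := hv
      exact ⟨t, ht, fun h => hvT (h ▸ ht), Or.inl hti.symm⟩
    · obtain ⟨i, hi, t, ht, hti⟩ := hv
      exact ⟨t, ht, fun h => hvT (h ▸ ht), Or.inr (mwGraph_adj_inr_inr.2 ⟨i, hi, hti⟩)⟩
  obtain ⟨v, hvT, hv⟩ := hne
  obtain ⟨u, hu, hl⟩ := hT.exists_legal (preconnected_not_inRegion hj)
    (fun v hv h => hv (hreg v h)) hadj ⟨v, hvT, fun h => h hv⟩
  exact ⟨u, not_not.1 hu, hl⟩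

theorem exists_mwB_ne (hk : 1 ≤ k) (i : Fin n) (z : Fin (2 * k + 1)) :
    ∃ z', mwB (k := k) i z' ≠ mwB i z := by
  have : Nontrivial (Fin (2 * k + 1)) := Fin.nontrivial_iff_two_le.2 (by omega)
  obtain ⟨z', hz'⟩ := exists_ne z
  exact ⟨z', fun h => hz' (mwB_injective i h)⟩

theorem legal_mwB {g : Game} (hk : 1 ≤ k) {T : Finset (MWBlowUpVertex n k)}
    (hT : IsPosition g (mwBlowUp n k) T) {i : Fin n} (hi : ¬ Opened T i) (z : Fin (2 * k + 1))
    (hadj : T = ∅ ∨ ∃ t ∈ T, (mwBlowUp n k).Adj (mwB i z) t) :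
    Legal g (mwBlowUp n k) (T : Set (MWBlowUpVertex n k)) (mwB i z) := by
  obtain ⟨z', hz'⟩ := exists_mwB_ne hk i z
  exact IsPosition.legal_of_twin hT (fun h => hi ⟨_, h, rfl⟩) (fun h => hi ⟨_, h, rfl⟩) hz' rfl hadj

/-- All neighbours of `a i` lie in one clique, of which only one vertex is taken; another vertex of
that clique dominates `a i`. -/
theorem legal_mwA {g : Game} (hk : 1 ≤ k) {T : Finset (MWBlowUpVertex n k)} {i : Fin n}
    {z : Fin (2 * k + 1)} (hT : IsPosition g (mwBlowUp n k) (insert (mwB i z) T))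
    (hi : ¬ Opened T i) (ha : mwA k i ∉ T) :
    Legal g (mwBlowUp n k) ((insert (mwB i z) T : Finset (MWBlowUpVertex n k)) :
      Set (MWBlowUpVertex n k)) (mwA k i) := by
  obtain ⟨z', hz'⟩ := exists_mwB_ne hk i z
  have hne : ∀ z, mwA k i ≠ mwB i z := fun z h => by simp [mwA, mwB, Sigma.ext_iff] at h
  refine hT.legal_of_dominated (v' := mwB i z') ?_ ?_ (hne _).symm ?_
    (Or.inr ⟨_, mem_insert_self _ _, mwBlowUp_adj_mwA_mwB⟩)
  · simp [ha, hne]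
  · simp only [mem_insert, not_or]
    exact ⟨hz', fun h => hi ⟨_, h, rfl⟩⟩
  · intro p _ hp
    by_cases hpz : p = mwB i z'
    · exact Or.inl hpz
    · exact Or.inr ⟨fun h => hpz h.symm, Or.inl (fst_of_mwBlowUp_adj_mwA hp).symm⟩

/-- On the blown-up Micek–Walczak graph, Bob secures all but one of the vertices `a i`. -/
theorem bobCanSecure_mwBlowUp (hn : 0 < n) (hk : 1 ≤ k) {g : Game} (hg : g.ruleT) :
    BobCanSecure g (mwBlowUp n k) (mwWeight n k) (n - 1) := by
  classical
  have hVne : Nonempty (MWBlowUpVertex n k) := ⟨mwA k ⟨0, hn⟩⟩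
  have hw : ∀ p, 0 ≤ mwWeight n k p := by
    rintro ⟨_ | _, _⟩ <;> simp [mwWeight]
  have hgain : ∀ T B : Finset (MWBlowUpVertex n k), AlmostAllOpened T B →
      (∀ i, Opened T i) → (n - 1 : ℝ) ≤ ∑ v ∈ B, mwWeight n k v := by
    rintro T B ⟨b, hb⟩ hT
    have := card_le_sum_of_mem hw (f := mwA k) mwA_injective
      (fun i => rfl) (univ.erase b) (B := B)
      (fun i hi => (hb i (hT i)).resolve_right (ne_of_mem_erase hi))
    rw [card_erase_of_mem (mem_univ _), card_univ, Fintype.card_fin] at this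
    rwa [Nat.cast_sub hn, Nat.cast_one] at this
  refine bobCanSecure_of_invariant hw (MWInvariant g) ?_ ?_ ?_
  · exact ⟨by simp, isPosition_empty (preconnected_mwBlowUp hn), by simp, by simp, ⟨0, hn⟩,
      by simp [Opened]⟩
  · rintro T B ⟨-, hT, hop, hreg, hB⟩
    by_cases hall : ∀ i, Opened T i
    · exact Or.inl (hgain T B hB hall)
    right
    push Not at hall
    obtain ⟨j, hj⟩ := hall
    rcases T.eq_empty_or_nonempty with rfl | hTne
    · exact ⟨_, legal_mwB hk hT hj 0 (Or.inl rfl)⟩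
    by_cases hr : ∃ v, v ∉ T ∧ InRegion (Opened T) v.1
    · obtain ⟨v, -, hv⟩ := exists_legal_inRegion hT hj hreg hr
      exact ⟨v, hv⟩
    · push Not at hr
      obtain ⟨i, hi⟩ := hop hTne
      -- With the region exhausted, `c {i, j}` is taken for an opened `i`, which makes the unopened
      -- `b j` accessible.
      let S : {S : Finset (Fin n) // S.Nonempty} := ⟨{i, j}, i, by simp⟩
      have hc : (⟨.inr (.inr S), (0 : Fin (2 * k + 1))⟩ : MWBlowUpVertex n k) ∈ T := by
        by_contra h
        exact hr _ h ⟨i, by simp [S], hi⟩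
      exact ⟨_, legal_mwB hk hT hj 0 (Or.inr ⟨_, hc, by simp [mwB, Sigma.ext_iff],
        Or.inr (mwGraph_adj_inr_inl.2 (Or.inr ⟨S, by simp [S], rfl⟩))⟩)⟩
  · rintro T B ⟨heven, hT, hop, hreg, b, hb⟩ v hv
    have hvT : v ∉ T := hv.1
    have hT1 := IsPosition.insert hg hv
    have hodd : ¬ Even (insert v T).card := by
      rw [card_insert_of_notMem hvT]
      exact Nat.not_even_iff_odd.2 heven.add_one
    have hfinish : ∀ u, Legal g (mwBlowUp n k)
        ((insert v T : Finset (MWBlowUpVertex n k)) : Set (MWBlowUpVertex n k)) u →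
        (∃ i, Opened (insert u (insert v T)) i) →
        (∀ p ∈ insert u (insert v T), InRegion (Opened (insert u (insert v T))) p.1) →
        AlmostAllOpened (insert u (insert v T)) (insert u B) →
        ∃ u, Legal g (mwBlowUp n k)
          ((insert v T : Finset (MWBlowUpVertex n k)) : Set (MWBlowUpVertex n k)) u ∧
          MWInvariant g (insert u (insert v T)) (insert u B) := by
      intro u hu h1 h2 h3
      refine ⟨u, hu, ?_, IsPosition.insert hg hu, fun _ => h1, h2, h3⟩
      have : u ∉ insert v T := hu.1
      rw [card_insert_of_notMem this]
      exact Nat.even_add_one.2 hodd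
    by_cases hopen : ∃ i, v.1 = .inr (.inl i) ∧ ¬ Opened T i
    · right
      obtain ⟨i, hvi, hi⟩ := hopen
      obtain ⟨v1, z⟩ := v
      obtain rfl : v1 = .inr (.inl i) := hvi
      -- Before `b i` is opened, `a i` lies outside the region that contains all taken vertices.
      have ha : mwA k i ∉ T := fun h => hi (hreg _ h)
      have hopi : Opened (insert (mwA k i) (insert (mwB i z) T)) i :=
        ⟨_, mem_insert_of_mem (mem_insert_self _ _), rfl⟩
      refine hfinish (mwA k i) (legal_mwA hk hT1 hi ha) ⟨i, hopi⟩ ?_ ⟨b, fun j hj => ?_⟩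
      · intro p hp
        rcases mem_insert.1 hp with rfl | hp
        · exact hopi
        rcases mem_insert.1 hp with rfl | hp
        · exact hopi
        · exact (hreg p hp).mono fun j hj =>
            opened_insert.2 (Or.inr (opened_insert.2 (Or.inr hj)))
      · rcases opened_insert.1 hj with h | h
        · simp [mwA] at h
        rcases opened_insert.1 h with h | h
        · obtain rfl : i = j := by simpa using h
          exact Or.inl (mem_insert_self _ _)
        · exact (hb j h).imp (mem_insert_of_mem ·) id
    push Not at hopen
    rcases T.eq_empty_or_nonempty with rfl | hTne
    · right
      -- If Alice starts at some `a i` or `c S`, Bob opens an adjacent `b i` himself; this `i` is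
      -- the single exception.
      have hstart : ∀ i, InRegion (fun j => j = i) v.1 →
          (mwBlowUp n k).Adj (mwB i 0) v → ¬ Opened (insert v ∅) i → ∃ u, Legal g (mwBlowUp n k)
          ((insert v ∅ : Finset (MWBlowUpVertex n k)) : Set (MWBlowUpVertex n k)) u ∧
          MWInvariant g (insert u (insert v ∅)) (insert u B) := by
        intro i hvi hadj hi
        have hopi : ∀ j, Opened (insert (mwB i 0) (insert v ∅)) j ↔ j = i := by
          intro j
          rw [opened_insert, opened_insert]
          constructor
          · rintro (h | h | ⟨p, hp, -⟩)
            · simpa [mwB, eq_comm] using h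
            · obtain ⟨p, hp, -⟩ := hopen j h
              simp at hp
            · simp at hp
          · rintro rfl
            exact Or.inl rfl
        refine hfinish (mwB i 0) (legal_mwB hk hT1 hi 0 (Or.inr ⟨v, by simp, hadj⟩))
          ⟨i, (hopi i).2 rfl⟩ ?_ ⟨i, fun j hj => Or.inr ((hopi j).1 hj)⟩
        intro p hp
        rcases mem_insert.1 hp with rfl | hp
        · exact (hopi i).2 rfl
        · obtain rfl : p = v := by simpa using hp
          exact hvi.mono fun j hj => (hopi j).2 hj
      have hno : ∀ i, ¬ Opened (insert v ∅) i := by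
        rintro i ⟨p, hp, hpi⟩
        obtain rfl : p = v := by simpa using hp
        obtain ⟨p, hp, -⟩ := hopen i hpi
        simp at hp
      obtain ⟨i | i | S, z⟩ := v
      · exact hstart i rfl
          ⟨by simp [mwB, Sigma.ext_iff], Or.inr (mwGraph_adj_inr_inl.2 (Or.inl rfl))⟩ (hno i)
      · exact absurd (hopen i rfl) (by simp [Opened])
      · obtain ⟨i, hi⟩ := S.2
        exact hstart i ⟨i, hi, rfl⟩ ⟨by simp [mwB, Sigma.ext_iff],
          Or.inr (mwGraph_adj_inr_inl.2 (Or.inr ⟨S, hi, rfl⟩))⟩ (hno i)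
    have hsame : ∀ i, Opened (insert v T) i ↔ Opened T i := fun i =>
      opened_insert.trans ⟨fun h => h.elim (hopen i) id, Or.inr⟩
    -- By rule (T), the region can be left only through a `b i` that is not yet opened.
    have hvreg : InRegion (Opened T) v.1 := by
      obtain ⟨t, ht, hvt⟩ := hv.exists_adj hg hTne
      rcases hvt.2 with h | h
      · rw [h]; exact hreg t ht
      · obtain ⟨i | i | S, z⟩ := v
        · exact ⟨t, ht, mwGraph_adj_inl.1 h⟩
        · exact hopen i rfl
        · obtain ⟨i, hi, h⟩ := mwGraph_adj_inr_inr.1 h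
          exact ⟨i, hi, t, ht, h⟩
    have hreg1 : ∀ p ∈ insert v T, InRegion (Opened (insert v T)) p.1 := by
      intro p hp
      refine InRegion.mono (fun i => (hsame i).2) ?_
      rcases mem_insert.1 hp with rfl | hp
      · exact hvreg
      · exact hreg p hp
    -- Once everything is opened, parity no longer gives a waiting turn, but Bob already has his
    -- share.
    by_cases hall : ∀ i, Opened T i
    · exact Or.inl (hgain T B ⟨b, hb⟩ hall)
    right
    push Not at hall
    obtain ⟨j, hj⟩ := hall
    have hj1 : ¬ Opened (insert v T) j := fun h => hj ((hsame j).1 h)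
    obtain ⟨u, hureg, hu⟩ := exists_legal_inRegion hT1 hj1 hreg1 (by
      by_contra hcon
      push Not at hcon
      refine hodd ?_
      have : insert v T =
          univ.filter fun p : MWBlowUpVertex n k => InRegion (Opened (insert v T)) p.1 := by
        ext p
        simp only [mem_filter, mem_univ, true_and]
        exact ⟨hreg1 p, fun h => by
          by_contra hp
          exact hcon p hp h⟩
      rw [this]
      exact even_card_inRegion hj1)
    have hsame2 : ∀ i, Opened (insert u (insert v T)) i ↔ Opened (insert v T) i := fun i =>
      opened_insert.trans ⟨fun h => h.elim (fun h => by rw [h] at hureg; exact hureg) id, Or.inr⟩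
    obtain ⟨i, hi⟩ := hop hTne
    refine hfinish u hu ⟨i, (hsame2 i).2 ((hsame i).2 hi)⟩ ?_ ⟨b, fun i hi =>
      (hb i ((hsame i).1 ((hsame2 i).1 hi))).imp (mem_insert_of_mem ·) id⟩
    intro p hp
    refine InRegion.mono (fun i => (hsame2 i).2) ?_
    rcases mem_insert.1 hp with rfl | hp
    · exact hureg
    · exact hreg1 p hp

theorem bobGetsAlmostAll_mwBlowUp (hn : 0 < n) (hk : 1 ≤ k) {ε : ℝ} (hε : 1 ≤ ε * n) {g : Game}
    (hg : g.ruleT) : BobGetsAlmostAll g (mwBlowUp n k) (mwWeight n k) ε := by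
  refine ⟨?_, ?_, (bobCanSecure_mwBlowUp hn hk hg).mono ?_⟩
  · rintro ⟨_ | _, _⟩ <;> simp [mwWeight]
  · rw [sum_mwWeight]
    exact_mod_cast hn
  · rw [sum_mwWeight]
    linarith

end MicekWalczak

/-! ### Bob's strategy in game R. -/

section Incidence

variable {V : Type} {m k : ℕ} {y : Fin m → V}
  {z : {S : Finset (Fin m) // S.card = k} → V} {T B : Finset V}

/-- Every remaining `z S` has a remaining neighbour `y i`. -/
def NoneStranded (y : Fin m → V) (z : {S : Finset (Fin m) // S.card = k} → V) (T : Finset V) :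
    Prop := ∀ S, z S ∉ T → ∃ i ∈ S.1, y i ∉ T

/-- The vertex `y i` remains and is not the only remaining neighbour of a remaining `z S`. -/
def Free (y : Fin m → V) (z : {S : Finset (Fin m) // S.card = k} → V) (T : Finset V)
    (i : Fin m) : Prop := y i ∉ T ∧ ∀ S, z S ∉ T → i ∈ S.1 → ∃ j ∈ S.1, j ≠ i ∧ y j ∉ T

open Classical in
/-- The free vertices. -/
noncomputable def freeSet (y : Fin m → V) (z : {S : Finset (Fin m) // S.card = k} → V)
    (T : Finset V) : Finset (Fin m) := univ.filter (Free y z T)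

theorem mem_freeSet {i : Fin m} : i ∈ freeSet y z T ↔ Free y z T i := by simp [freeSet]

variable [DecidableEq V]

/-- The vertices `y i` that remain. -/
def remainingSet (y : Fin m → V) (T : Finset V) : Finset (Fin m) := univ.filter fun i => y i ∉ T

/-- The vertices `y i` that have been taken. -/
def takenIndices (y : Fin m → V) (T : Finset V) : Finset (Fin m) := univ.filter fun i => y i ∈ T

/-- The vertices `y i` that Alice has taken. -/
def lostSet (y : Fin m → V) (T B : Finset V) : Finset (Fin m) :=
  univ.filter fun i => y i ∈ T ∧ y i ∉ B

theorem mem_remainingSet {i : Fin m} : i ∈ remainingSet y T ↔ y i ∉ T := by simp [remainingSet]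

theorem mem_takenIndices {i : Fin m} : i ∈ takenIndices y T ↔ y i ∈ T := by simp [takenIndices]

theorem mem_lostSet {i : Fin m} : i ∈ lostSet y T B ↔ y i ∈ T ∧ y i ∉ B := by simp [lostSet]

theorem card_remainingSet_add_card_takenIndices :
    (remainingSet y T).card + (takenIndices y T).card = m := by
  have := card_filter_add_card_filter_not (s := (univ : Finset (Fin m))) (fun i => y i ∈ T)
  rw [card_univ, Fintype.card_fin] at this
  rw [remainingSet, takenIndices]
  omega

theorem lostSet_subset_takenIndices : lostSet y T B ⊆ takenIndices y T := fun _ hi =>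
  mem_takenIndices.2 (mem_lostSet.1 hi).1

theorem card_takenIndices_insert_le (hy : Function.Injective y) (v : V) :
    (takenIndices y (insert v T)).card ≤ (takenIndices y T).card + 1 := by
  by_cases h : ∃ i, y i = v
  · obtain ⟨i, rfl⟩ := h
    refine (card_le_card fun j hj => ?_).trans (card_insert_le i _)
    rw [mem_takenIndices, mem_insert] at hj
    exact mem_insert.2 (hj.imp (fun h => hy h) mem_takenIndices.2)
  · refine (card_le_card fun j hj => ?_).trans (Nat.le_succ _)
    rw [mem_takenIndices, mem_insert] at hj
    exact mem_takenIndices.2 (hj.resolve_left fun h' => h ⟨j, h'⟩)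

theorem card_lostSet_insert_le (hy : Function.Injective y) (v : V) :
    (lostSet y (insert v T) B).card ≤ (lostSet y T B).card + 1 := by
  by_cases h : ∃ i, y i = v
  · obtain ⟨i, rfl⟩ := h
    refine (card_le_card fun j hj => ?_).trans (card_insert_le i _)
    rw [mem_lostSet, mem_insert] at hj
    exact mem_insert.2 (hj.1.imp (fun h => hy h) fun h => mem_lostSet.2 ⟨h, hj.2⟩)
  · refine (card_le_card fun j hj => ?_).trans (Nat.le_succ _)
    rw [mem_lostSet, mem_insert] at hj
    exact mem_lostSet.2 ⟨hj.1.resolve_left fun h' => h ⟨j, h'⟩, hj.2⟩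

theorem lostSet_insert_of_ne {v : V} (hv : ∀ i, v ≠ y i) :
    lostSet y (insert v T) B = lostSet y T B := by
  ext i
  simp [mem_lostSet, (hv i).symm]

theorem lostSet_insert_insert (v : V) :
    lostSet y (insert v T) (insert v B) ⊆ lostSet y T B := by
  intro i hi
  simp only [mem_lostSet, mem_insert, not_or] at hi ⊢
  exact ⟨hi.1.resolve_left hi.2.1, hi.2.2⟩

/-- If at least `k - 1` vertices `y i` are taken, then each free one requires a taken `z S`. -/
theorem card_freeSet_le (hk : 1 ≤ k) (hz : Function.Injective z)
    (h : k ≤ (takenIndices y T).card + 1) : (freeSet y z T).card ≤ T.card := by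
  obtain ⟨A, hA, hAk⟩ := exists_subset_card_eq (by omega : k - 1 ≤ (takenIndices y T).card)
  have hiA : ∀ {i}, Free y z T i → i ∉ A := fun hi h => hi.1 (mem_takenIndices.1 (hA h))
  have hcard : ∀ {i}, i ∉ A → (insert i A).card = k := fun h => by
    rw [card_insert_of_notMem h]; omega
  -- With `A` a set of `k - 1` taken indices, a remaining `z (insert i A)` would have `y i` as its
  -- only remaining neighbour. So it is taken when `i` is free, and distinct `i` give distinct sets.
  -- The value `y i` is a dummy.
  refine card_le_card_of_injOn
    (fun i => if h : i ∉ A then z ⟨insert i A, hcard h⟩ else y i) ?_ ?_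
  · intro i hi
    have hi := mem_freeSet.1 hi
    simp only [dif_pos (hiA hi)]
    by_contra hcon
    obtain ⟨j, hj, hji, hjT⟩ := hi.2 _ hcon (mem_insert_self _ _)
    exact hjT (mem_takenIndices.1 (hA ((mem_insert.1 hj).resolve_left hji)))
  · intro i hi j hj hij
    have hi := hiA (mem_freeSet.1 hi)
    have hj := hiA (mem_freeSet.1 hj)
    simp only [dif_pos hi, dif_pos hj] at hij
    have h1 : insert i A = insert j A := congrArg Subtype.val (hz hij)
    have h2 : i ∈ insert j A := h1 ▸ mem_insert_self _ _
    exact (mem_insert.1 h2).resolve_right hi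

/-- A `k`-set has `k - 1` elements besides `i`, too many for all of them to be taken. So in the
opening phase every remaining `y i` is free. -/
theorem free_of_card_takenIndices_le (h : (takenIndices y T).card + 2 ≤ k) {i : Fin m}
    (hi : y i ∉ T) : Free y z T i := by
  refine ⟨hi, fun S _ hiS => ?_⟩
  have h1 : (takenIndices y T).card < (S.1.erase i).card := by
    rw [card_erase_of_mem hiS, S.2]; omega
  obtain ⟨j, hj, hjT⟩ := exists_mem_notMem_of_card_lt_card h1
  exact ⟨j, mem_of_mem_erase hj, ne_of_mem_erase hj, fun h => hjT (mem_takenIndices.2 h)⟩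

theorem freeSet_insert_y (hyz : ∀ i S, y i ≠ z S) (i : Fin m) :
    freeSet y z (insert (y i) T) ⊆ (freeSet y z T).erase i := by
  intro j hj
  obtain ⟨hj1, hj2⟩ := mem_freeSet.1 hj
  rw [mem_insert, not_or] at hj1
  refine mem_erase.2 ⟨fun h => hj1.1 (congrArg y h), mem_freeSet.2 ⟨hj1.2, fun S hS hjS => ?_⟩⟩
  obtain ⟨l, hl, hlj, hlT⟩ := hj2 S (by simp [hS, (hyz i S).symm]) hjS
  exact ⟨l, hl, hlj, fun h => hlT (mem_insert_of_mem h)⟩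

theorem card_freeSet_insert_y (hyz : ∀ i S, y i ≠ z S) {i : Fin m} (hi : Free y z T i) :
    (freeSet y z (insert (y i) T)).card + 1 ≤ (freeSet y z T).card := by
  have h1 := card_le_card (freeSet_insert_y (T := T) hyz i)
  have h2 := card_pos.2 ⟨i, mem_freeSet.2 hi⟩
  rw [card_erase_of_mem (mem_freeSet.2 hi)] at h1
  omega

/-- A `y i` that becomes free was blocked by `z S` alone, hence was its only remaining neighbour;
there is at most one such `i`. -/
theorem card_freeSet_insert_z (hz : Function.Injective z)
    (S : {S : Finset (Fin m) // S.card = k}) :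
    (freeSet y z (insert (z S) T)).card ≤ (freeSet y z T).card + 1 := by
  have key : ∀ i ∈ freeSet y z (insert (z S) T), i ∉ freeSet y z T →
      i ∈ S.1 ∧ y i ∉ T ∧ ∀ j ∈ S.1, j ≠ i → y j ∈ T := by
    intro i hi hi'
    obtain ⟨h1, h2⟩ := mem_freeSet.1 hi
    rw [mem_insert, not_or] at h1
    rw [mem_freeSet, Free, not_and] at hi'
    have h3 := hi' h1.2
    push Not at h3
    obtain ⟨S', hS', hiS', h4⟩ := h3
    obtain rfl : S' = S := by
      by_contra hne
      obtain ⟨j, hj, hji, hjT⟩ := h2 S' (by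
        rw [mem_insert, not_or]
        exact ⟨fun h => hne (hz h), hS'⟩) hiS'
      exact hjT (mem_insert_of_mem (h4 j hj hji))
    exact ⟨hiS', h1.2, h4⟩
  by_cases h : ∃ i ∈ freeSet y z (insert (z S) T), i ∉ freeSet y z T
  · obtain ⟨i, hi, hi'⟩ := h
    obtain ⟨-, -, h3⟩ := key i hi hi'
    refine (card_le_card fun j hj => ?_).trans (card_insert_le i _)
    by_contra hcon
    rw [mem_insert, not_or] at hcon
    obtain ⟨h4, h5, -⟩ := key j hj hcon.2
    exact h5 (h3 j h4 hcon.1)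
  · push Not at h
    exact (card_le_card h).trans (Nat.le_succ _)

theorem freeSet_insert_of_ne {v : V} (hvy : ∀ i, v ≠ y i) (hvz : ∀ S, v ≠ z S) :
    freeSet y z (insert v T) = freeSet y z T := by
  ext i
  simp [mem_freeSet, Free, (hvy _).symm, (hvz _).symm]

/-- What Bob's strategy in game R needs to know about a graph that contains the incidence graph
of `Fin m` and its `k`-element subsets, where `J` holds as long as the rest of the graph is in
good shape. -/
structure IncidenceGame (G : SimpleGraph V) (y : Fin m → V)
    (z : {S : Finset (Fin m) // S.card = k} → V) (J : Finset V → Prop) : Prop where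
  y_injective : Function.Injective y
  z_injective : Function.Injective z
  y_ne_z : ∀ i S, y i ≠ z S
  preconnected_iff : ∀ T : Finset V, J T → (∃ i, y i ∉ T) →
    ((G.induce (T : Set V)ᶜ).Preconnected ↔ NoneStranded y z T)
  empty : J ∅
  insert_y : ∀ T i, J T → J (insert (y i) T)
  insert_z : ∀ T S, J T → J (insert (z S) T)
  insert_alice : ∀ T v, J T → Even T.card → v ∉ T →
    (G.induce ((insert v T : Finset V) : Set V)ᶜ).Preconnected →
    2 ≤ (remainingSet y (insert v T)).card → J (insert v T)
  exists_insert : ∀ T, J T → Odd T.card → (∀ i, ¬ Free y z T i) →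
    (∀ S, z S ∉ T → ∃ i, Free y z (insert (z S) T) i) → (∃ i, y i ∉ T) →
    ∃ x, x ∉ T ∧ (∀ i, x ≠ y i) ∧ (∀ S, x ≠ z S) ∧ J (insert x T)

/-- The positions that Bob can maintain after his moves. -/
structure IncidenceInvariant (y : Fin m → V) (z : {S : Finset (Fin m) // S.card = k} → V)
    (J : Finset V → Prop) (T B : Finset V) : Prop where
  even : Even T.card
  rest : J T
  noneStranded : NoneStranded y z T
  two_le : 2 ≤ (remainingSet y T).card
  potential : (T.card ≤ 2 * (takenIndices y T).card ∧ (takenIndices y T).card + 2 ≤ k) ∨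
    (lostSet y T B).card + (freeSet y z T).card ≤ 4 * k

variable {G : SimpleGraph V} {J : Finset V → Prop}

theorem IncidenceGame.legal (hG : IncidenceGame G y z J) {v : V} (hv : v ∉ T)
    (hJ : J (insert v T)) (hy : ∃ i, y i ∉ insert v T) (hs : NoneStranded y z (insert v T)) :
    Legal Game.R G (T : Set V) v := by
  refine ⟨hv, False.elim, fun _ => ?_⟩
  rw [← coe_insert]
  exact (hG.preconnected_iff _ hJ hy).2 hs

theorem IncidenceGame.exists_legal (hG : IncidenceGame G y z J) (hJ : J T)
    (hs : NoneStranded y z T) (h2 : 2 ≤ (remainingSet y T).card) :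
    ∃ v, Legal Game.R G (T : Set V) v := by
  obtain ⟨i, hi, j, hj, hij⟩ := one_lt_card.1 h2
  rw [mem_remainingSet] at hi hj
  by_cases h : ∃ S, z S ∉ T
  · obtain ⟨S, hS⟩ := h
    refine ⟨z S, hG.legal hS (hG.insert_z _ _ hJ) ⟨i, by simp [hi, hG.y_ne_z]⟩ fun S' hS' => ?_⟩
    rw [mem_insert, not_or] at hS'
    obtain ⟨l, hl, hlT⟩ := hs S' hS'.2
    exact ⟨l, hl, by simp [hlT, hG.y_ne_z]⟩
  · push Not at h
    refine ⟨y i, hG.legal hi (hG.insert_y _ _ hJ) ⟨j, ?_⟩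
      fun S hS => absurd (mem_insert_of_mem (h S)) hS⟩
    rw [mem_insert, not_or]
    exact ⟨fun h => hij (hG.y_injective h).symm, hj⟩

/-- The effect of a move of Alice on the potential. -/
theorem IncidenceGame.potential_insert (hG : IncidenceGame G y z J) (hk : 1 ≤ k) {v : V}
    (hv : v ∉ T) (hs : NoneStranded y z (insert v T))
    (h : (T.card ≤ 2 * (takenIndices y T).card ∧ (takenIndices y T).card + 2 ≤ k) ∨
      (lostSet y T B).card + (freeSet y z T).card ≤ 4 * k) :
    ((insert v T).card ≤ 2 * (takenIndices y (insert v T)).card + 1 ∧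
      (takenIndices y (insert v T)).card + 2 ≤ k) ∨
    ((lostSet y (insert v T) B).card + (freeSet y z (insert v T)).card ≤ 4 * k + 1 ∧
      ((freeSet y z (insert v T)).card = 0 → (lostSet y (insert v T) B).card ≤ 4 * k)) := by
  rcases h with ⟨h1, h2⟩ | h
  · have h3 : (takenIndices y T).card ≤ (takenIndices y (insert v T)).card :=
      card_le_card fun i hi => mem_takenIndices.2 (mem_insert_of_mem (mem_takenIndices.1 hi))
    have h4 := card_takenIndices_insert_le (T := T) hG.y_injective v
    have h5 := card_insert_le v T
    by_cases h6 : (takenIndices y (insert v T)).card + 2 ≤ k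
    · left; omega
    · right
      -- The opening phase ends here with fewer than `2 * k` vertices taken, which bounds both the
      -- lost and the free ones; `4 * k` is generous.
      have h7 := card_freeSet_le (T := insert v T) (y := y) hk hG.z_injective (by omega)
      have h8 := card_le_card (lostSet_subset_takenIndices (y := y) (T := insert v T) (B := B))
      omega
  · right
    by_cases hvy : ∃ i, y i = v
    · obtain ⟨i, rfl⟩ := hvy
      -- Rule (R) lets Alice take only a free `y i`, so what she gains is paid for by the drop in
      -- the number of free vertices.
      have hfree : Free y z T i := by
        refine ⟨hv, fun S hS hiS => ?_⟩
        obtain ⟨j, hj, hjT⟩ := hs S (by simp [hS, (hG.y_ne_z i S).symm])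
        rw [mem_insert, not_or] at hjT
        exact ⟨j, hj, fun h => hjT.1 (congrArg y h), hjT.2⟩
      have h1 := card_freeSet_insert_y hG.y_ne_z hfree
      have h2 := card_lostSet_insert_le (T := T) (B := B) hG.y_injective (y i)
      omega
    push Not at hvy
    rw [lostSet_insert_of_ne fun i => (hvy i).symm]
    by_cases hvz : ∃ S, z S = v
    · obtain ⟨S, rfl⟩ := hvz
      have := card_freeSet_insert_z (T := T) (y := y) hG.z_injective S
      omega
    · push Not at hvz
      rw [freeSet_insert_of_ne (fun i => (hvy i).symm) fun S => (hvz S).symm]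
      omega

/-- In game R, Bob secures all but a bounded number of the vertices `y i`. -/
theorem IncidenceGame.bobCanSecure (hG : IncidenceGame G y z J) (hk : 1 ≤ k) (hm : k + 2 ≤ m)
    {w : V → ℝ} (hw : ∀ v, 0 ≤ w v) (hwy : ∀ i, w (y i) = 1) :
    BobCanSecure Game.R G w (m - (4 * k + 3)) := by
  have hVne : Nonempty V := ⟨y ⟨0, by omega⟩⟩
  have hgain : ∀ T B : Finset V, (remainingSet y T).card ≤ 2 →
      (lostSet y T B).card ≤ 4 * k + 1 → (m - (4 * k + 3) : ℝ) ≤ ∑ v ∈ B, w v := by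
    intro T B h1 h2
    have h3 := card_le_sum_of_mem hw hG.y_injective hwy (univ.filter fun i => y i ∈ B) (B := B)
      (fun i hi => (mem_filter.1 hi).2)
    have h4 : m ≤ (remainingSet y T).card + (lostSet y T B).card +
        (univ.filter fun i => y i ∈ B).card := by
      calc m = (univ : Finset (Fin m)).card := by simp
        _ ≤ (remainingSet y T ∪ lostSet y T B ∪ univ.filter fun i => y i ∈ B).card := by
          refine card_le_card fun i _ => ?_
          simp only [mem_union, mem_remainingSet, mem_lostSet, mem_filter, mem_univ, true_and]
          tauto
        _ ≤ _ := (card_union_le _ _).trans (Nat.add_le_add_right (card_union_le _ _) _)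
    -- The deficit is at most two remaining vertices, `4 * k` lost ones and one more from Alice's
    -- latest turn.
    have h5 : (m : ℝ) ≤ 2 + (4 * k + 1) + (univ.filter fun i => y i ∈ B).card := by
      exact_mod_cast h4.trans (by omega)
    linarith
  refine bobCanSecure_of_invariant hw (IncidenceInvariant y z J) ?_ ?_ ?_
  · refine ⟨by simp, hG.empty, fun S _ => ?_, ?_, ?_⟩
    · obtain ⟨i, hi⟩ := card_pos.1 (by rw [S.2]; omega : 0 < S.1.card)
      exact ⟨i, hi, by simp⟩
    · simp only [remainingSet, notMem_empty, not_false_eq_true, filter_true, card_univ,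
        Fintype.card_fin]
      omega
    · have h1 : takenIndices y ∅ = ∅ := by ext; simp [mem_takenIndices]
      have h2 : lostSet y ∅ ∅ = ∅ := by ext; simp [mem_lostSet]
      rw [h1, h2]
      by_cases h : 2 ≤ k
      · left; simpa using h
      · right
        have := card_freeSet_le (T := ∅) (y := y) hk hG.z_injective (by omega)
        simp at this ⊢
        simp [this]
  · intro T B h
    exact Or.inr (hG.exists_legal h.rest h.noneStranded h.two_le)
  · intro T B hI v hv
    have hvT : v ∉ T := hv.1
    by_cases h2 : (remainingSet y (insert v T)).card ≤ 2
    · left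
      refine hgain (insert v T) B h2 ?_
      have h3 := card_lostSet_insert_le (T := T) (B := B) hG.y_injective v
      have h4 := card_takenIndices_insert_le (T := T) hG.y_injective v
      have h5 := card_remainingSet_add_card_takenIndices (y := y) (T := insert v T)
      have h6 := hI.potential
      -- The opening phase cannot last this long: after Alice's turn at most `k - 1` of the `m ≥ k +
      -- 2` vertices would be taken, leaving at least three.
      omega
    right
    have hpre : (G.induce ((insert v T : Finset V) : Set V)ᶜ).Preconnected := by
      rw [coe_insert]; exact hv.2.2 trivial
    have hJ := hG.insert_alice T v hI.rest hI.even hvT hpre (by omega)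
    obtain ⟨j, hj⟩ : ∃ j, y j ∉ insert v T := by
      obtain ⟨j, hj⟩ := card_pos.1 (by omega : 0 < (remainingSet y (insert v T)).card)
      exact ⟨j, mem_remainingSet.1 hj⟩
    have hs := (hG.preconnected_iff _ hJ ⟨j, hj⟩).1 hpre
    have hpot := hG.potential_insert (B := B) hk hvT hs hI.potential
    have hodd : ¬ Even (insert v T).card := by
      rw [card_insert_of_notMem hvT]
      exact Nat.not_even_iff_odd.2 hI.even.add_one
    generalize hT' : insert v T = T' at *
    have heven : ∀ u, u ∉ T' → Even (insert u T').card := fun u hu => by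
      rw [card_insert_of_notMem hu]
      exact Nat.even_add_one.2 hodd
    by_cases hfree : ∃ i, Free y z T' i
    · obtain ⟨i, hi⟩ := hfree
      have hrem : (remainingSet y T').card ≤ (remainingSet y (insert (y i) T')).card + 1 := by
        have h3 := card_takenIndices_insert_le (T := T') hG.y_injective (y i)
        have h4 := card_remainingSet_add_card_takenIndices (y := y) (T := insert (y i) T')
        have h5 := card_remainingSet_add_card_takenIndices (y := y) (T := T')
        omega
      have hs' : NoneStranded y z (insert (y i) T') := by
        intro S hS
        rw [mem_insert, not_or] at hS
        obtain ⟨j, hj, hjT⟩ := hs S hS.2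
        by_cases hji : j = i
        · subst hji
          obtain ⟨l, hl, hlj, hlT⟩ := hi.2 S hS.2 hj
          refine ⟨l, hl, ?_⟩
          rw [mem_insert, not_or]
          exact ⟨fun h => hlj (hG.y_injective h), hlT⟩
        · refine ⟨j, hj, ?_⟩
          rw [mem_insert, not_or]
          exact ⟨fun h => hji (hG.y_injective h), hjT⟩
      refine ⟨y i, hG.legal hi.1 (hG.insert_y _ _ hJ) ?_ hs', heven _ hi.1,
        hG.insert_y _ _ hJ, hs', by omega, ?_⟩
      · obtain ⟨j, hj⟩ := card_pos.1
          (by omega : 0 < (remainingSet y (insert (y i) T')).card)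
        exact ⟨j, mem_remainingSet.1 hj⟩
      · have h1 := card_freeSet_insert_y hG.y_ne_z hi
        have h2 := card_le_card (lostSet_insert_insert (y := y) (T := T') (B := B) (y i))
        rcases hpot with ⟨h3, h4⟩ | h3
        · have h5 : (takenIndices y T').card + 1 ≤ (takenIndices y (insert (y i) T')).card := by
            have h6 : i ∉ takenIndices y T' := fun h => hi.1 (mem_takenIndices.1 h)
            rw [← card_insert_of_notMem h6]
            refine card_le_card fun l hl => mem_takenIndices.2 ?_
            rcases mem_insert.1 hl with rfl | hl
            · exact mem_insert_self _ _
            · exact mem_insert_of_mem (mem_takenIndices.1 hl)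
          have h6 := card_insert_le (y i) T'
          have h7 := card_takenIndices_insert_le (T := T') hG.y_injective (y i)
          by_cases h8 : (takenIndices y (insert (y i) T')).card + 2 ≤ k
          · left; omega
          · right
            have h9 := card_freeSet_le (T := insert (y i) T') (y := y) hk hG.z_injective
              (by omega)
            have h10 := card_le_card (lostSet_subset_takenIndices (y := y)
              (T := insert (y i) T') (B := insert (y i) B))
            omega
        · right; omega
    · push Not at hfree
      have hf0 : freeSet y z T' = ∅ := by
        ext i
        simp [mem_freeSet, hfree]
      -- The opening phase is excluded because every remaining `y i` would be free in it.
      -- Afterwards, a turn of Alice that leaves nothing free has not raised the potential above `4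
      -- * k`.
      have hlost : (lostSet y T' B).card ≤ 4 * k := by
        rcases hpot with ⟨-, h⟩ | h
        · exact absurd (free_of_card_takenIndices_le h hj) (hfree j)
        · exact h.2 (by rw [hf0, card_empty])
      have hmove : ∀ u, u ∉ T' → (∀ i, u ≠ y i) → J (insert u T') →
          (∀ i, ¬ Free y z (insert u T') i) → ∃ u, Legal Game.R G (T' : Set V) u ∧
            IncidenceInvariant y z J (insert u T') (insert u B) := by
        intro u hu huy hJu hfu
        have hs' : NoneStranded y z (insert u T') := by
          intro S hS
          rw [mem_insert, not_or] at hS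
          obtain ⟨l, hl, hlT⟩ := hs S hS.2
          exact ⟨l, hl, by simp [hlT, (huy l).symm]⟩
        have hrem : remainingSet y (insert u T') = remainingSet y T' := by
          ext i; simp [mem_remainingSet, (huy i).symm]
        refine ⟨u, hG.legal hu hJu ⟨j, by simp [hj, (huy j).symm]⟩ hs', heven u hu, hJu, hs',
          by rw [hrem]; omega, Or.inr ?_⟩
        have h1 : freeSet y z (insert u T') = ∅ := by
          ext i
          simp [mem_freeSet, hfu]
        have h2 := card_le_card (lostSet_insert_insert (y := y) (T := T') (B := B) u)
        rw [h1, card_empty]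
        omega
      -- Bob needs a waiting turn that frees nothing: some `z S`, or else the vertex `x` that parity
      -- provides.
      by_cases hrem : ∃ S, z S ∉ T' ∧ ∀ i, ¬ Free y z (insert (z S) T') i
      · obtain ⟨S, hS, hSf⟩ := hrem
        exact hmove (z S) hS (fun i => (hG.y_ne_z i S).symm) (hG.insert_z _ _ hJ) hSf
      · push Not at hrem
        obtain ⟨x, hx, hxy, hxz, hJx⟩ := hG.exists_insert T' hJ (Nat.not_even_iff_odd.1 hodd)
          hfree hrem ⟨j, hj⟩
        refine hmove x hx hxy hJx fun i hi => ?_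
        rw [← mem_freeSet, freeSet_insert_of_ne hxy hxz, hf0] at hi
        simp at hi

/-- If no vertex `y i` is free but the removal of any `z S` makes one free, then the remaining
vertices `y i` and `z S` are matched to each other. -/
theorem exists_matching_of_not_free (hz : Function.Injective z)
    (hfree : ∀ i, ¬ Free y z T i) (hrem : ∀ S, z S ∉ T → ∃ i, Free y z (insert (z S) T) i) :
    (univ.filter fun S => z S ∉ T).card = (remainingSet y T).card ∧
      ∀ S, z S ∉ T → ∀ i ∈ S.1, ∀ j ∈ S.1, y i ∉ T → y j ∉ T → i = j := by
  have hblock : ∀ i, y i ∉ T → ∃ S, z S ∉ T ∧ i ∈ S.1 ∧ ∀ j ∈ S.1, j ≠ i → y j ∈ T := by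
    intro i hi
    have := hfree i
    rw [Free, not_and] at this
    have := this hi
    push Not at this
    exact this
  rcases isEmpty_or_nonempty {S : Finset (Fin m) // S.card = k} with hempty | _
  · refine ⟨?_, fun S => isEmptyElim S⟩
    rw [univ_eq_empty, filter_empty, card_empty, eq_comm, card_eq_zero, eq_empty_iff_forall_notMem]
    intro i hi
    obtain ⟨S, -⟩ := hblock i (mem_remainingSet.1 hi)
    exact isEmptyElim S
  -- `b i` is a blocker of `y i`, having it as its only remaining neighbour; this `b` is the
  -- matching.
  choose! b hb1 hb2 hb3 using hblock
  have hbij : ∀ S, z S ∉ T → ∃ i, y i ∉ T ∧ b i = S := by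
    intro S hS
    obtain ⟨i, hi1, hi2⟩ := hrem S hS
    have hi : y i ∉ T := fun h => hi1 (mem_insert_of_mem h)
    refine ⟨i, hi, ?_⟩
    by_contra hne
    obtain ⟨j, hj, hji, hjT⟩ := hi2 (b i) (by
      rw [mem_insert, not_or]
      exact ⟨fun h => hne (hz h), hb1 i hi⟩) (hb2 i hi)
    exact hjT (mem_insert_of_mem (hb3 i hi j hj hji))
  constructor
  · symm
    refine card_bij (fun i _ => b i) ?_ ?_ ?_
    · intro i hi
      exact mem_filter.2 ⟨mem_univ _, hb1 i (mem_remainingSet.1 hi)⟩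
    · intro i hi j hj hij
      by_contra hne
      have hi := mem_remainingSet.1 hi
      have hj := mem_remainingSet.1 hj
      exact hj (hb3 i hi j (hij ▸ hb2 j hj) fun h => hne h.symm)
    · intro S hS
      obtain ⟨i, hi, h⟩ := hbij S (mem_filter.1 hS).2
      exact ⟨i, mem_remainingSet.2 hi, h⟩
  · intro S hS i hi j hj hiT hjT
    obtain ⟨l, hl, rfl⟩ := hbij S hS
    have h1 : i = l := by
      by_contra h
      exact hiT (hb3 l hl i hi h)
    have h2 : j = l := by
      by_contra h
      exact hjT (hb3 l hl j hj h)
    rw [h1, h2]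

end Incidence

/-! ### Game R with an odd number of vertices: the bipartite incidence graph. -/

section XYZ

variable {m k : ℕ}

theorem xyzGraph_adj_inl {a : Fin (m + m.choose k + 3)} {v : XYZVertex m k} :
    (xyzGraph m k).Adj (.inl a) v ↔ ∃ i, v = .inr (.inl i) := by
  rcases v with a' | i | S <;> simp [xyzGraph]

theorem xyzGraph_adj_inr_inr {S : {S : Finset (Fin m) // S.card = k}} {v : XYZVertex m k} :
    (xyzGraph m k).Adj (.inr (.inr S)) v ↔ ∃ i ∈ S.1, v = .inr (.inl i) := by
  rcases v with a' | i | S' <;> simp [xyzGraph]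

/-- The vertices `Y` of the incidence graph. -/
def xyzY (m k : ℕ) (i : Fin m) : XYZVertex m k := .inr (.inl i)

/-- The vertices `Z` of the incidence graph. -/
def xyzZ (m k : ℕ) (S : {S : Finset (Fin m) // S.card = k}) : XYZVertex m k := .inr (.inr S)

theorem xyzY_injective (m k : ℕ) : Function.Injective (xyzY m k) :=
  Sum.inr_injective.comp Sum.inl_injective

theorem xyzZ_injective (m k : ℕ) : Function.Injective (xyzZ m k) :=
  Sum.inr_injective.comp Sum.inr_injective

/-- Every vertex of `X` or `Z` has neighbours only in `Y`. -/
theorem preconnected_xyzGraph_iff {T : Finset (XYZVertex m k)} (hx : ∃ a, .inl a ∉ T)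
    (hy : ∃ i, xyzY m k i ∉ T) :
    ((xyzGraph m k).induce (T : Set (XYZVertex m k))ᶜ).Preconnected ↔
      NoneStranded (xyzY m k) (xyzZ m k) T := by
  obtain ⟨a, ha⟩ := hx
  obtain ⟨i, hi⟩ := hy
  constructor
  · intro h S hS
    obtain ⟨x, v, -, hv, hxS, -, hadj⟩ := exists_adj_of_preconnected h {xyzZ m k S} hS hi rfl
      (by simp [xyzY, xyzZ])
    rw [Set.mem_singleton_iff] at hxS
    subst hxS
    obtain ⟨j, hj, rfl⟩ := xyzGraph_adj_inr_inr.1 hadj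
    exact ⟨j, hj, hv⟩
  · intro h
    have hY : ∀ j (hj : xyzY m k j ∉ T),
        ((xyzGraph m k).induce (T : Set (XYZVertex m k))ᶜ).Reachable ⟨xyzY m k j, hj⟩
          ⟨.inl a, ha⟩ := fun j hj =>
      SimpleGraph.Adj.reachable (xyzGraph_adj_inl.2 ⟨j, rfl⟩ : (xyzGraph m k).Adj _ _).symm
    refine preconnected_of_forall_reachable ⟨.inl a, ha⟩ ?_
    rintro ⟨b | j | S, hv⟩
    · refine .trans (SimpleGraph.Adj.reachable ?_) (hY i hi)
      exact (xyzGraph_adj_inl.2 ⟨i, rfl⟩ : (xyzGraph m k).Adj _ _)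
    · exact hY j hv
    · obtain ⟨j, hj, hjT⟩ := h S hv
      refine .trans (SimpleGraph.Adj.reachable ?_) (hY j hjT)
      exact (xyzGraph_adj_inr_inr.2 ⟨j, hj, rfl⟩ : (xyzGraph m k).Adj _ _)

theorem card_remaining_sum {α β : Type} [Fintype α] [Fintype β] [DecidableEq α] [DecidableEq β]
    (T : Finset (α ⊕ β)) : (univ.filter fun a => .inl a ∉ T).card +
      (univ.filter fun b => .inr b ∉ T).card + T.card = Fintype.card (α ⊕ β) := by
  have : Tᶜ = (univ.filter fun a => .inl a ∉ T).disjSum (univ.filter fun b => .inr b ∉ T) := by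
    ext (a | b) <;> simp
  rw [← card_disjSum, ← this, card_compl_add_card]

theorem card_remaining_inr {α β γ : Type} [Fintype β] [Fintype γ]
    [DecidableEq α] [DecidableEq β] [DecidableEq γ] (T : Finset (α ⊕ (β ⊕ γ))) :
    (univ.filter fun b : β ⊕ γ => .inr b ∉ T).card =
      (univ.filter fun b : β => .inr (.inl b) ∉ T).card +
      (univ.filter fun c : γ => .inr (.inr c) ∉ T).card := by
  rw [← card_disjSum]
  congr 1
  ext (b | c) <;> simp

theorem card_subtype_card (m k : ℕ) :
    Fintype.card {S : Finset (Fin m) // S.card = k} = m.choose k := by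
  rw [Fintype.card_finset_len, Fintype.card_fin]

theorem odd_card_xyzVertex (m k : ℕ) : Odd (Fintype.card (XYZVertex m k)) := by
  rw [Fintype.card_sum, Fintype.card_sum, card_subtype_card, Fintype.card_fin, Fintype.card_fin]
  exact ⟨m + m.choose k + 1, by ring⟩

theorem isBipartite_xyzGraph (m k : ℕ) : (xyzGraph m k).IsBipartite := by
  let C : (xyzGraph m k).Coloring Bool := SimpleGraph.Coloring.mk
    (fun v => match v with
      | .inr (.inl _) => true
      | _ => false) (by
      rintro (a | i | S) (a' | i' | S') h <;> simp [xyzGraph] at h ⊢)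
  simpa using C.colorable

/-- Fewer than `k` deletions leave each `z` one of its `k` neighbours and spare some vertex of `X`
and of `Y`. -/
theorem isKConnected_xyzGraph (hm : k ≤ m) : IsKConnected (xyzGraph m k) k := by
  constructor
  · rw [Fintype.card_sum, Fintype.card_fin]
    omega
  intro F hF
  have hX : ∃ a, .inl a ∉ F := by
    by_contra hcon
    push Not at hcon
    have := card_le_card (image_subset_iff.2 fun a _ => hcon a : univ.image
      (Sum.inl : Fin (m + m.choose k + 3) → XYZVertex m k) ⊆ F)
    rw [card_image_of_injective _ Sum.inl_injective, card_univ, Fintype.card_fin] at this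
    omega
  have hY : ∀ s : Finset (Fin m), k ≤ s.card → ∃ i ∈ s, xyzY m k i ∉ F := by
    intro s hs
    by_contra hcon
    push Not at hcon
    have := card_le_card (image_subset_iff.2 hcon)
    rw [card_image_of_injective _ (xyzY_injective m k)] at this
    omega
  obtain ⟨i, -, hi⟩ := hY univ (by simpa using hm)
  exact connected_iff_preconnected.2
    ⟨(preconnected_xyzGraph_iff hX ⟨i, hi⟩).2 fun S _ => hY S.1 S.2.ge, _, hi⟩

/-- Enough vertices of `X` remain for Bob: either more than of `Y` and `Z` together, or the
vertices of `X` hold the remaining graph together. -/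
def XRemains (T : Finset (XYZVertex m k)) : Prop :=
  (∃ a, .inl a ∉ T) ∧
  ((univ.filter fun p => .inr p ∉ T).card + 2 ≤ (univ.filter fun a => .inl a ∉ T).card ∨
    ∀ S, xyzZ m k S ∉ T → ∀ i ∈ S.1, ∀ j ∈ S.1, xyzY m k i ∉ T → xyzY m k j ∉ T → i = j)

theorem XRemains.insert_inr {T : Finset (XYZVertex m k)} (h : XRemains T)
    (p : Fin m ⊕ {S : Finset (Fin m) // S.card = k}) : XRemains (insert (.inr p) T) := by
  obtain ⟨⟨a, ha⟩, h⟩ := h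
  refine ⟨⟨a, by simpa using ha⟩, h.imp (fun h => ?_) fun h S hS i hi j hj hiT hjT => ?_⟩
  · have h1 : (univ.filter fun p' => .inr p' ∉ insert (.inr p) T).card ≤
        (univ.filter fun p => .inr p ∉ T).card :=
      card_le_card fun q hq => by
        simp only [mem_filter, mem_univ, true_and, mem_insert, not_or] at hq ⊢
        exact hq.2
    simpa using le_trans (Nat.add_le_add_right h1 2) h
  · simp only [mem_insert, not_or] at hS hiT hjT
    exact h S hS.2 i hi j hj hiT.2 hjT.2

/-- If every remaining vertex of `Z` has at most one remaining neighbour, then the vertices of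
`X` cannot all be taken before `Y` is almost exhausted. -/
theorem exists_inl_notMem_of_preconnected {T : Finset (XYZVertex m k)}
    (h : ∀ S, xyzZ m k S ∉ T → ∀ i ∈ S.1, ∀ j ∈ S.1, xyzY m k i ∉ T → xyzY m k j ∉ T → i = j)
    (hT : ((xyzGraph m k).induce (T : Set (XYZVertex m k))ᶜ).Preconnected)
    (h2 : 2 ≤ (remainingSet (xyzY m k) T).card) : ∃ a, .inl a ∉ T := by
  obtain ⟨i, hi, j, hj, hij⟩ := one_lt_card.1 h2
  rw [mem_remainingSet] at hi hj
  -- Consider `y i` with its neighbours in `Z`. Those that remain have no other remaining neighbour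
  -- in `Y`, so a remaining edge leaving this set ends in `X`.
  obtain ⟨u, v, hu, hv, huW, hvW, hadj⟩ := exists_adj_of_preconnected hT
    ({xyzY m k i} ∪ {v | ∃ S, v = xyzZ m k S ∧ i ∈ S.1}) hi hj (Or.inl rfl) (by
      rintro (h | ⟨S, h, -⟩)
      · exact hij (Sum.inl_injective (Sum.inr_injective h)).symm
      · simp [xyzY, xyzZ] at h)
  rcases v with a | l | S
  · exact ⟨a, hv⟩
  · exfalso
    rcases huW with rfl | ⟨S, rfl, hiS⟩
    · simp [xyzY, xyzGraph] at hadj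
    · obtain ⟨l', hl', h'⟩ := xyzGraph_adj_inr_inr.1 hadj
      obtain rfl : l = l' := Sum.inl_injective (Sum.inr_injective h')
      refine hvW (Or.inl ?_)
      rw [h S hu i hiS l hl' hi hv]
      rfl
  · exfalso
    obtain ⟨l, hl, rfl⟩ := xyzGraph_adj_inr_inr.1 hadj.symm
    rcases huW with h' | ⟨S', h', -⟩
    · obtain rfl : l = i := Sum.inl_injective (Sum.inr_injective h')
      exact hvW (Or.inr ⟨S, rfl, hl⟩)
    · simp [xyzZ] at h'

theorem incidenceGame_xyzGraph (m k : ℕ) :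
    IncidenceGame (xyzGraph m k) (xyzY m k) (xyzZ m k) XRemains where
  y_injective := xyzY_injective m k
  z_injective := xyzZ_injective m k
  y_ne_z := by simp [xyzY, xyzZ]
  preconnected_iff _ hT hy := preconnected_xyzGraph_iff hT.1 hy
  empty := by
    refine ⟨⟨⟨0, by omega⟩, by simp⟩, Or.inl ?_⟩
    simp only [notMem_empty, not_false_eq_true, filter_true, card_univ, Fintype.card_fin,
      Fintype.card_sum, card_subtype_card]
    omega
  insert_y _ i h := h.insert_inr (.inl i)
  insert_z _ S h := h.insert_inr (.inr S)
  insert_alice T v h heven hv hpre h2 := by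
    rcases v with a | p
    swap
    · exact h.insert_inr p
    have hrest : (univ.filter fun p => .inr p ∉ insert (.inl a) T) =
        univ.filter fun p => .inr p ∉ T := by
      ext p; simp
    have hX : (univ.filter fun b => .inl b ∉ T).card ≤
        (univ.filter fun b => .inl b ∉ insert (.inl a) T).card + 1 := by
      refine le_trans (card_le_card fun b hb => ?_) (card_insert_le a _)
      by_cases hba : b = a
      · simp [hba]
      · simpa [hba] using hb
    rcases h.2 with h1 | h1
    · have h3 := card_remaining_sum T
      have h4 := odd_card_xyzVertex m k
      rw [← h3] at h4
      -- An odd number of vertices remains before Alice's turn, so a surplus of two in `X` is in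
      -- fact at least three and survives the loss of one vertex.
      have h5 : (univ.filter fun p => .inr p ∉ T).card + 3 ≤
          (univ.filter fun a => .inl a ∉ T).card := by
        obtain ⟨r, hr⟩ := heven
        obtain ⟨s, hs⟩ := h4
        omega
      constructor
      · obtain ⟨b, hb⟩ := card_pos.1
          (by omega : 0 < (univ.filter fun b => .inl b ∉ insert (.inl a) T).card)
        exact ⟨b, by simpa using hb⟩
      · left
        rw [hrest]
        omega
    · have h3 : ∀ S, xyzZ m k S ∉ insert (.inl a) T → ∀ i ∈ S.1, ∀ j ∈ S.1,
          xyzY m k i ∉ insert (.inl a) T → xyzY m k j ∉ insert (.inl a) T → i = j := by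
        intro S hS i hi j hj hiT hjT
        simp only [mem_insert, not_or] at hS hiT hjT
        exact h1 S hS.2 i hi j hj hiT.2 hjT.2
      exact ⟨exists_inl_notMem_of_preconnected h3 hpre h2, Or.inr h3⟩
  exists_insert T h hodd hfree hrem hy := by
    obtain ⟨h1, h2⟩ := exists_matching_of_not_free (xyzZ_injective m k) hfree hrem
    have h3 := card_remaining_sum T
    have h4 := odd_card_xyzVertex m k
    rw [← h3, card_remaining_inr] at h4
    have h5 : 0 < (univ.filter fun a => .inl a ∉ T).card := by
      obtain ⟨a, ha⟩ := h.1
      exact card_pos.2 ⟨a, by simpa using ha⟩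
    -- An even number of vertices remains and those of `Y` and `Z` are matched, so `X` keeps a
    -- positive even number: Bob can spend one and keep one.
    have h6 : 1 < (univ.filter fun a => .inl a ∉ T).card := by
      obtain ⟨r, hr⟩ := hodd
      obtain ⟨s, hs⟩ := h4
      change (univ.filter fun S => .inr (.inr S) ∉ T).card =
        (univ.filter fun i => .inr (.inl i) ∉ T).card at h1
      omega
    obtain ⟨a, ha, b, hb, hab⟩ := one_lt_card.1 h6
    simp only [mem_filter, mem_univ, true_and] at ha hb
    refine ⟨.inl a, ha, by simp [xyzY], by simp [xyzZ], ⟨b, by simp [hb, hab.symm]⟩, Or.inr ?_⟩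
    intro S hS i hi j hj hiT hjT
    simp only [mem_insert, not_or] at hS hiT hjT
    exact h2 S hS.2 i hi j hj hiT.2 hjT.2

theorem sum_xyzWeight (m k : ℕ) : ∑ p, xyzWeight m k p = m := by
  simp [Fintype.sum_sum_type, xyzWeight]

theorem bobGetsAlmostAll_xyzGraph (hk : 1 ≤ k) (hm : k + 2 ≤ m) {ε : ℝ}
    (hε : 4 * k + 3 ≤ ε * m) : BobGetsAlmostAll Game.R (xyzGraph m k) (xyzWeight m k) ε := by
  have hw : ∀ p, 0 ≤ xyzWeight m k p := by
    rintro (_ | _ | _) <;> simp [xyzWeight]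
  refine ⟨hw, ?_, ((incidenceGame_xyzGraph m k).bobCanSecure hk hm hw fun _ => rfl).mono ?_⟩
  · rw [sum_xyzWeight]
    exact_mod_cast (by omega : 0 < m)
  · rw [sum_xyzWeight]
    linarith

end XYZ

/-! ### Game R with an even number of vertices: the clique with attached vertices. -/

section Clique

variable {n k : ℕ}

/-- The clique in `cliqueGraph`. -/
def cliqueA (n k : ℕ) (i : Fin n) : CliqueVertex n k := .inl i

/-- The vertices of `cliqueGraph` outside of the clique. -/
def cliqueB (n k : ℕ) (S : {S : Finset (Fin n) // S.card = k}) : CliqueVertex n k := .inr S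

theorem cliqueA_injective (n k : ℕ) : Function.Injective (cliqueA n k) := Sum.inl_injective

theorem cliqueB_injective (n k : ℕ) : Function.Injective (cliqueB n k) := Sum.inr_injective

theorem cliqueGraph_adj_inr {S : {S : Finset (Fin n) // S.card = k}} {v : CliqueVertex n k} :
    (cliqueGraph n k).Adj (.inr S) v ↔ ∃ i ∈ S.1, v = .inl i := by
  rcases v with i | S' <;> simp [cliqueGraph]

theorem preconnected_cliqueGraph_iff {T : Finset (CliqueVertex n k)}
    (hy : ∃ i, cliqueA n k i ∉ T) :
    ((cliqueGraph n k).induce (T : Set (CliqueVertex n k))ᶜ).Preconnected ↔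
      NoneStranded (cliqueA n k) (cliqueB n k) T := by
  obtain ⟨i, hi⟩ := hy
  constructor
  · intro h S hS
    obtain ⟨x, v, -, hv, hxS, -, hadj⟩ := exists_adj_of_preconnected h {cliqueB n k S} hS hi rfl
      (by simp [cliqueA, cliqueB])
    rw [Set.mem_singleton_iff] at hxS
    subst hxS
    obtain ⟨j, hj, rfl⟩ := cliqueGraph_adj_inr.1 hadj
    exact ⟨j, hj, hv⟩
  · intro h
    have hA : ∀ j (hj : cliqueA n k j ∉ T),
        ((cliqueGraph n k).induce (T : Set (CliqueVertex n k))ᶜ).Reachable ⟨cliqueA n k j, hj⟩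
          ⟨cliqueA n k i, hi⟩ := fun j hj => by
      by_cases hji : j = i
      · subst hji; exact .refl _
      · refine SimpleGraph.Adj.reachable ?_
        change (cliqueGraph n k).Adj (.inl j) (.inl i)
        simp [cliqueGraph, hji]
    refine preconnected_of_forall_reachable ⟨cliqueA n k i, hi⟩ ?_
    rintro ⟨j | S, hv⟩
    · exact hA j hv
    · obtain ⟨j, hj, hjT⟩ := h S hv
      refine .trans (SimpleGraph.Adj.reachable ?_) (hA j hjT)
      exact (cliqueGraph_adj_inr.2 ⟨j, hj, rfl⟩ : (cliqueGraph n k).Adj _ _)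

/-- The order `2 ^ m` of the clique is chosen because the binomial coefficients of a power of two
are even away from the ends. -/
theorem even_card_cliqueVertex {m : ℕ} (hk : 1 ≤ k) (hm : k < 2 ^ m) :
    Even (Fintype.card (CliqueVertex (2 ^ m) k)) := by
  rw [Fintype.card_sum, card_subtype_card, Fintype.card_fin]
  refine Even.add (even_two.pow_of_ne_zero ?_) (even_iff_two_dvd.2
    (Nat.prime_two.dvd_choose_pow (by omega) hm.ne))
  rintro rfl
  omega

theorem isKConnected_cliqueGraph (hn : k < n) : IsKConnected (cliqueGraph n k) k := by
  constructor
  · rw [Fintype.card_sum, Fintype.card_fin]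
    omega
  intro F hF
  have hA : ∀ s : Finset (Fin n), k ≤ s.card → ∃ i ∈ s, cliqueA n k i ∉ F := by
    intro s hs
    by_contra hcon
    push Not at hcon
    have := card_le_card (image_subset_iff.2 hcon)
    rw [card_image_of_injective _ (cliqueA_injective n k)] at this
    omega
  obtain ⟨i, -, hi⟩ := hA univ (by simpa using hn.le)
  exact connected_iff_preconnected.2
    ⟨(preconnected_cliqueGraph_iff ⟨i, hi⟩).2 fun S _ => hA S.1 S.2.ge, _, hi⟩

/-- The clique holds the graph together, so `J` is trivial. The matched situation would leave an
even number of vertices at Bob's turn, which the parity hypothesis rules out, so no spare vertex is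
needed. -/
theorem incidenceGame_cliqueGraph (heven : Even (Fintype.card (CliqueVertex n k))) :
    IncidenceGame (cliqueGraph n k) (cliqueA n k) (cliqueB n k) fun _ => True where
  y_injective := cliqueA_injective n k
  z_injective := cliqueB_injective n k
  y_ne_z := by simp [cliqueA, cliqueB]
  preconnected_iff _ _ hy := preconnected_cliqueGraph_iff hy
  empty := trivial
  insert_y _ _ _ := trivial
  insert_z _ _ _ := trivial
  insert_alice _ _ _ _ _ _ _ := trivial
  exists_insert T _ hodd hfree hrem _ := by
    obtain ⟨h1, -⟩ := exists_matching_of_not_free (cliqueB_injective n k) hfree hrem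
    rw [← card_remaining_sum T] at heven
    change (univ.filter fun S => .inr S ∉ T).card = (univ.filter fun i => .inl i ∉ T).card at h1
    obtain ⟨r, hr⟩ := hodd
    obtain ⟨s, hs⟩ := heven
    omega

theorem sum_cliqueWeight (n k : ℕ) : ∑ p, cliqueWeight n k p = n := by
  simp [Fintype.sum_sum_type, cliqueWeight]

theorem bobGetsAlmostAll_cliqueGraph (heven : Even (Fintype.card (CliqueVertex n k)))
    (hk : 1 ≤ k) (hn : k + 2 ≤ n) {ε : ℝ} (hε : 4 * k + 3 ≤ ε * n) :
    BobGetsAlmostAll Game.R (cliqueGraph n k) (cliqueWeight n k) ε := by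
  have hw : ∀ p, 0 ≤ cliqueWeight n k p := by
    rintro (_ | _) <;> simp [cliqueWeight]
  refine ⟨hw, ?_, ((incidenceGame_cliqueGraph heven).bobCanSecure hk hn hw fun _ => rfl).mono ?_⟩
  · rw [sum_cliqueWeight]
    exact_mod_cast (by omega : 0 < n)
  · rw [sum_cliqueWeight]
    linarith

end Clique

/-! ### The four families for large parameters, and the theorem. -/

theorem exists_le_mul {ε : ℝ} (hε : 0 < ε) (c : ℝ) : ∃ N : ℕ, ∀ n ≥ N, c ≤ ε * (n : ℝ) := by
  obtain ⟨N, hN⟩ := exists_nat_ge (c / ε)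
  refine ⟨N, fun n hn => ?_⟩
  have h1 : (N : ℝ) ≤ n := Nat.cast_le.2 hn
  rw [div_le_iff₀ hε] at hN
  nlinarith

theorem exists_cycleBlowUp {k : ℕ} (hk : 1 ≤ k) {ε : ℝ} (hε : 0 < ε) : ∃ N : ℕ, ∀ n ≥ N,
    Even (Fintype.card (CycleVertex n k)) ∧ IsKConnected (cycleBlowUp n k) k ∧
    BobGetsAlmostAll Game.T (cycleBlowUp n k) (cycleWeight n k) ε ∧
    BobGetsAlmostAll Game.TR (cycleBlowUp n k) (cycleWeight n k) ε := by
  obtain ⟨N, hN⟩ := exists_le_mul hε 1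
  refine ⟨max N 2, fun n hn => ?_⟩
  have h1 := hN n (le_of_max_le_left hn)
  have h2 : 2 ≤ n := le_of_max_le_right hn
  exact ⟨even_card_cycleVertex n k, isKConnected_cycleBlowUp h2 hk,
    bobGetsAlmostAll_cycleBlowUp h2 hk h1 trivial, bobGetsAlmostAll_cycleBlowUp h2 hk h1 trivial⟩

theorem exists_xyzGraph {k : ℕ} (hk : 1 ≤ k) {ε : ℝ} (hε : 0 < ε) : ∃ N : ℕ, ∀ m ≥ N,
    Odd (Fintype.card (XYZVertex m k)) ∧ (xyzGraph m k).IsBipartite ∧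
    IsKConnected (xyzGraph m k) k ∧
    BobGetsAlmostAll Game.R (xyzGraph m k) (xyzWeight m k) ε := by
  obtain ⟨N, hN⟩ := exists_le_mul hε (4 * k + 3)
  refine ⟨max N (k + 2), fun m hm => ?_⟩
  have h2 : k + 2 ≤ m := le_of_max_le_right hm
  exact ⟨odd_card_xyzVertex m k, isBipartite_xyzGraph m k, isKConnected_xyzGraph (by omega),
    bobGetsAlmostAll_xyzGraph hk h2 (hN m (le_of_max_le_left hm))⟩

theorem exists_mwBlowUp {k : ℕ} (hk : 1 ≤ k) {ε : ℝ} (hε : 0 < ε) : ∃ N : ℕ, ∀ n ≥ N,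
    Odd (Fintype.card (Σ v : MWVertex n, Fin (mwSize n k v))) ∧
    IsKConnected (mwBlowUp n k) (2 * k + 1) ∧
    BobGetsAlmostAll Game.T (mwBlowUp n k) (mwWeight n k) ε ∧
    BobGetsAlmostAll Game.TR (mwBlowUp n k) (mwWeight n k) ε := by
  obtain ⟨N, hN⟩ := exists_le_mul hε 1
  refine ⟨max N 1, fun n hn => ?_⟩
  have h1 := hN n (le_of_max_le_left hn)
  have h2 : 0 < n := le_of_max_le_right hn
  exact ⟨odd_card_mwBlowUpVertex h2, isKConnected_mwBlowUp h2,
    bobGetsAlmostAll_mwBlowUp h2 hk h1 trivial, bobGetsAlmostAll_mwBlowUp h2 hk h1 trivial⟩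

theorem exists_cliqueGraph {k : ℕ} (hk : 1 ≤ k) {ε : ℝ} (hε : 0 < ε) : ∃ N : ℕ, ∀ m ≥ N,
    Even (Fintype.card (CliqueVertex (2 ^ m) k)) ∧ IsKConnected (cliqueGraph (2 ^ m) k) k ∧
    BobGetsAlmostAll Game.R (cliqueGraph (2 ^ m) k) (cliqueWeight (2 ^ m) k) ε := by
  obtain ⟨N, hN⟩ := exists_le_mul hε (4 * k + 3)
  refine ⟨max N (k + 2), fun m hm => ?_⟩
  have h1 : m < 2 ^ m := Nat.lt_two_pow_self
  have h2 : k + 2 ≤ m := le_of_max_le_right hm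
  have h3 : N ≤ m := le_of_max_le_left hm
  have heven := even_card_cliqueVertex hk (by omega : k < 2 ^ m)
  exact ⟨heven, isKConnected_cliqueGraph (by omega),
    bobGetsAlmostAll_cliqueGraph heven hk (by omega) (hN _ (by omega))⟩

end GraphSharing

theorem theorem1 (k : ℕ) (hk : 1 ≤ k) (ε : ℝ) (hε : 0 < ε) :
    -- existence, for each game and each parity of the number of vertices; game TR is played on
    -- 2-connected graphs only
    (∀ g : Game,
      (∃ (V : Type) (_ : Fintype V) (G : SimpleGraph V) (w : V → ℝ),
        Even (Fintype.card V) ∧ IsKConnected G k ∧ (g = Game.TR → IsKConnected G 2) ∧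
        BobGetsAlmostAll g G w ε) ∧
      (∃ (V : Type) (_ : Fintype V) (G : SimpleGraph V) (w : V → ℝ),
        Odd (Fintype.card V) ∧ IsKConnected G k ∧ (g = Game.TR → IsKConnected G 2) ∧
        BobGetsAlmostAll g G w ε)) ∧
    -- games T and TR, even number of vertices: blown-up even cycles
    (∃ N : ℕ, ∀ n ≥ N, Even (Fintype.card (CycleVertex n k)) ∧
      IsKConnected (cycleBlowUp n k) k ∧
      BobGetsAlmostAll Game.T (cycleBlowUp n k) (cycleWeight n k) ε ∧
      BobGetsAlmostAll Game.TR (cycleBlowUp n k) (cycleWeight n k) ε) ∧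
    -- game R, odd number of vertices: bipartite incidence graphs
    (∃ N : ℕ, ∀ m ≥ N, Odd (Fintype.card (XYZVertex m k)) ∧
      (xyzGraph m k).IsBipartite ∧
      IsKConnected (xyzGraph m k) k ∧
      BobGetsAlmostAll Game.R (xyzGraph m k) (xyzWeight m k) ε) ∧
    -- games T and TR, odd number of vertices: blow-ups of the Micek–Walczak graphs
    (∃ N : ℕ, ∀ n ≥ N, Odd (Fintype.card (Σ v : MWVertex n, Fin (mwSize n k v))) ∧
      IsKConnected (mwBlowUp n k) (2 * k + 1) ∧
      BobGetsAlmostAll Game.T (mwBlowUp n k) (mwWeight n k) ε ∧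
      BobGetsAlmostAll Game.TR (mwBlowUp n k) (mwWeight n k) ε) ∧
    -- game R, even number of vertices: cliques with vertices attached to the `k`-element subsets
    (∃ N : ℕ, ∀ m ≥ N, Even (Fintype.card (CliqueVertex (2 ^ m) k)) ∧
      IsKConnected (cliqueGraph (2 ^ m) k) k ∧
      BobGetsAlmostAll Game.R (cliqueGraph (2 ^ m) k) (cliqueWeight (2 ^ m) k) ε) := by
  -- Building the graphs for T and TR with `max k 2` makes them 2-connected, as game TR demands,
  -- also when `k = 1`.
  have hk2 : 1 ≤ max k 2 := hk.trans (le_max_left _ _)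
  obtain ⟨n₁, h₁⟩ := exists_cycleBlowUp hk2 hε
  obtain ⟨n₂, h₂⟩ := exists_xyzGraph hk hε
  obtain ⟨n₃, h₃⟩ := exists_mwBlowUp hk2 hε
  obtain ⟨n₄, h₄⟩ := exists_cliqueGraph hk hε
  obtain ⟨he₁, hc₁, ht₁, htr₁⟩ := h₁ n₁ le_rfl
  obtain ⟨he₂, -, hc₂, hr₂⟩ := h₂ n₂ le_rfl
  obtain ⟨he₃, hc₃, ht₃, htr₃⟩ := h₃ n₃ le_rfl
  obtain ⟨he₄, hc₄, hr₄⟩ := h₄ n₄ le_rfl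
  have hck₁ := hc₁.mono (le_max_left k 2)
  have hck₃ := hc₃.mono (by omega : k ≤ 2 * max k 2 + 1)
  refine ⟨?_, exists_cycleBlowUp hk hε, exists_xyzGraph hk hε, exists_mwBlowUp hk hε,
    exists_cliqueGraph hk hε⟩
  rintro (_ | _ | _)
  · exact ⟨⟨_, _, _, _, he₁, hck₁, nofun, ht₁⟩, ⟨_, _, _, _, he₃, hck₃, nofun, ht₃⟩⟩
  · exact ⟨⟨_, _, _, _, he₄, hc₄, nofun, hr₄⟩, ⟨_, _, _, _, he₂, hc₂, nofun, hr₂⟩⟩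
  · exact ⟨⟨_, _, _, _, he₁, hck₁, fun _ => hc₁.mono (le_max_right k 2), htr₁⟩,
      ⟨_, _, _, _, he₃, hck₃, fun _ => hc₃.mono (by omega), htr₃⟩⟩
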